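/- \textbf{Conventions.} A \emph{piecewise C*-algebra} is a set $A$ with a reflexive symmetric relation $\odot$ (commeasurability), elements $0,1$, an involution $*\colon A\to A$, a scalar multiplication $\mathbb C\times A\to A$, a function $\|-\|\colon A\to\mathbb R$, and partial operations $+,\cdot\colon\odot\to A$, such that every set of pairwise commeasurable elements is contained in a set of pairwise commeasurable elements that is a commutative (unital) C*-algebra under these operations. Put $\mathrm{Proj}(A)=\{p: p^*=p=p^2\}$ and $U(A)=\{u: u\odot u^*,\ uu^*=1\}$. A \emph{piecewise AW*-algebra} is a piecewise C*-algebra $A$ with a function $\mathrm{RP}\colon A\to \mathrm{Proj}(A)$ and an operation $\bigvee$ assigning to each pairwise commeasurable set of projections a projection, such that to every pairwise commeasurable set $S\subseteq A$ one can assign a pairwise commeasurable set $T(S)\supseteq S$ that is a commutative AW*-algebra under the operations of $A$ (right supporting projections being given by $\mathrm{RP}$ and suprema of projections by $\bigvee$), coherently: if $S\subseteq S'$ then $T(S)$ is an AW*-subalgebra of $T(S')$. (An AW*-algebra is a C*-algebra in which the right annihilator of any subset is generated as a right ideal by a projection.) A \emph{morphism} of piecewise AW*-algebras is a function preserving $\odot$,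 $1$, $+$ and $\cdot$ on commeasurable pairs, scalar multiplication, $*$, and $\bigvee$ of pairwise commeasurable sets of projections. A \emph{complete orthomodular lattice} is a complete lattice $P$ with an order-reversing involution $p\mapsto p^\perp$ such that $p\vee p^\perp=1$, $p\wedge p^\perp=0$, and $p\vee(p^\perp\wedge q)=q$ whenever $p\le q$; morphisms preserve $\perp$ and arbitrary suprema. Elements $p,q\in P$ are commeasurable if there are pairwise orthogonal $p',q',r$ with $p=p'\vee r$, $q=q'\vee r$. For a complete orthomodular lattice $P$, the piecewise algebra $F(P)$ is the colimit (disjoint union modulo the equivalence relation generated by inclusions) of the algebras $C(\mathrm{Stone}(C),\mathbb C)$, where $C$ ranges over the pairwise commeasurable subsets of $P$ closed under $\perp$ and arbitrary suprema (these are complete Boolean algebras), and $\mathrm{Stone}(C)$ is the Stone space of $C$; two classes are commeasurable if they have representatives in a common $C(\mathrm{Stone}(C),\mathbb C)$, and all operations are computed on representatives. A morphism $f\colon P\to P'$ induces $Ff\colon F(P)\to F(P')$. If $A$ is a piecewise AW*-algebra or of the form $F(P)$, a \emph{group in $U(A)$ generated by symmetries} is a subset $G\subseteq U(A)$ with a group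 structure such that elements of $G$ commute in $G$ if and only if they are commeasurable in $A$, in which case their products in $G$ and in $A$ agree, with unit $1$ and inverse $*$, and such that $G$ contains, and is generated as a group by, the elements $1-2p$ for $p\in\mathrm{Proj}(A)$. The category $\mathbf{EAWstar}$ of \emph{extended piecewise AW*-algebras} has as objects the tuples $(A,P,G,\cdot)$ where $A$ is a piecewise AW*-algebra; $P$ is a complete orthomodular lattice structure on the set $\mathrm{Proj}(A)$ whose commeasurability, orthocomplement and suprema of commeasurable sets are those of $\mathrm{Proj}(A)$ (with $p^\perp=1-p$); $G$ is a group in $U(A)$ generated by symmetries; and $\cdot$ is an action of $G$ on $A$ by automorphisms of piecewise AW*-algebras with $g\cdot h=ghg^{-1}$ for $g,h\in G$. Morphisms are the morphisms $f\colon A\to A'$ of piecewise AW*-algebras that restrict to a morphism $P\to P'$ of complete orthomodular lattices and to a group homomorphism $G\to G'$, with $f(u\cdot a)=f(u)\cdot' f(a)$ for $u\in G$, $a\in A$. The category $\mathbf{AL}$ of \emph{active lattices} has as objects the tuples $(P,G,\cdot)$ where $P$ is a complete orthomodular lattice; $G$ is a group in $U(F(P))$ generated by symmetries; and $\cdot$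 is an action of $G$ on $P$ by automorphisms of complete orthomodular lattices such that the induced action on $F(P)$ satisfies $F(g\cdot(-))(h)=ghg^{-1}$ for $g,h\in G$. Morphisms are the morphisms $f\colon P\to P'$ of complete orthomodular lattices such that $Ff$ restricts to a group homomorphism $G\to G'$ and $f(u\cdot p)=Ff(u)\cdot' f(p)$ for $u\in G$, $p\in P$. \textbf{Proposition.} The categories $\mathbf{EAWstar}$ and $\mathbf{AL}$ are equivalent. -/

import Mathlib

universe u

open CategoryTheory

namespace ActiveLattices

noncomputable section

/-! ### Piecewise structures -/

/-- The operations of a piecewise C*-algebra (no axioms besides reflexivity and symmetry of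
commeasurability). Addition and multiplication are defined on commeasurable pairs only. -/
class PiecewiseOps (A : Type u) extends Zero A, One A, Star A, SMul ℂ A, Norm A where
  Comm : A → A → Prop
  comm_refl : ∀ a, Comm a a
  comm_symm : ∀ a b, Comm a b → Comm b a
  add : ∀ a b, Comm a b → A
  mul : ∀ a b, Comm a b → A

open PiecewiseOps (Comm comm_refl comm_symm)

/-- A set of pairwise commeasurable elements. -/
def PairwiseComm {A : Type u} [PiecewiseOps A] (S : Set A) : Prop :=
  ∀ a ∈ S, ∀ b ∈ S, Comm a b

/-- Projections: self-adjoint idempotents. -/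
abbrev Proj (A : Type u) [PiecewiseOps A] : Type u :=
  {p : A // star p = p ∧ PiecewiseOps.mul p p (comm_refl p) = p}

/-- Pairwise commeasurable sets of projections. -/
def PairwiseCommProj {A : Type u} [PiecewiseOps A] (X : Set (Proj A)) : Prop :=
  ∀ p ∈ X, ∀ q ∈ X, Comm (p : A) (q : A)

/-- The C*-algebra structure on the pairwise commeasurable set `T` is given by the operations of
the piecewise algebra `A`. -/
structure IsCommCStarOn {A : Type u} [PiecewiseOps A] (T : Set A) [CommCStarAlgebra T] :
    Prop where
  pairwiseComm : PairwiseComm T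
  coe_zero : ((0 : T) : A) = 0
  coe_one : ((1 : T) : A) = 1
  coe_star : ∀ a : T, ((star a : T) : A) = star (a : A)
  coe_smul : ∀ (z : ℂ) (a : T), ((z • a : T) : A) = z • (a : A)
  norm_coe : ∀ a : T, ‖(a : A)‖ = ‖a‖
  coe_add : ∀ (a b : T) (h : Comm (a : A) (b : A)), ((a + b : T) : A) = PiecewiseOps.add _ _ h
  coe_mul : ∀ (a b : T) (h : Comm (a : A) (b : A)), ((a * b : T) : A) = PiecewiseOps.mul _ _ h

/-- A piecewise C*-algebra. -/
class PiecewiseCStarAlgebra (A : Type u) extends PiecewiseOps A where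
  exists_commCStar : ∀ S : Set A, PairwiseComm S →
    ∃ T : Set A, S ⊆ T ∧ ∃ _ : CommCStarAlgebra T, IsCommCStarOn T

/-- An AW*-algebra: a C*-algebra in which the right annihilator of every subset is generated, as a
right ideal, by a projection. -/
def IsAWStar (R : Type u) [CStarAlgebra R] : Prop :=
  ∀ S : Set R, ∃ p : R, IsStarProjection p ∧
    {y : R | ∀ x ∈ S, x * y = 0} = Set.range (fun r : R => p * r)

/-- The set `T` forms a commutative AW*-algebra under the operations of the piecewise algebra `A`
and the given operations `rp` (right supporting projection) and `sup` (suprema of commeasurable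
sets of projections). Recall that `p ≤ q` means `p * q = p` for projections. -/
structure IsCommAWStarOn {A : Type u} [PiecewiseOps A] (rp : A → Proj A)
    (sup : ∀ X : Set (Proj A), PairwiseCommProj X → Proj A)
    (T : Set A) [CommCStarAlgebra T] : Prop extends IsCommCStarOn T where
  isAWStar : IsAWStar T
  coe_rp : ∀ a : T, ∃ p : T, (p : A) = rp a ∧ a * p = a ∧
    ∀ q : T, IsStarProjection q → a * q = a → p * q = p
  coe_sup : ∀ (X : Set (Proj A)) (hX : PairwiseCommProj X), (∀ x ∈ X, (x : A) ∈ T) →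
    ∃ p : T, (p : A) = sup X hX ∧
      (∀ x : T, (∃ y ∈ X, (y : A) = x) → x * p = x) ∧
      ∀ q : T, IsStarProjection q → (∀ x : T, (∃ y ∈ X, (y : A) = x) → x * q = x) → p * q = p

/-- A piecewise AW*-algebra. Every commeasurable set `S` is contained in a commeasurable set `T S`
forming a commutative AW*-algebra, and coherently so: if `S ⊆ S'` then `T S` is an AW*-subalgebra
of `T S'`. (Since all operations, including `rp` and `sup`, are those of `A`, the inclusion
`T S ⊆ T S'` says precisely this.) -/
class PiecewiseAWStar (A : Type u) extends PiecewiseCStarAlgebra A where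
  rp : A → Proj A
  sup : ∀ X : Set (Proj A), PairwiseCommProj X → Proj A
  exists_commAWStar : ∃ T : Set A → Set A,
    (∀ S, PairwiseComm S →
      S ⊆ T S ∧ ∃ _ : CommCStarAlgebra (T S), IsCommAWStarOn rp sup (T S)) ∧
    ∀ S S', PairwiseComm S → PairwiseComm S' → S ⊆ S' → T S ⊆ T S'

/-- A map preserving commeasurability, the partial ring operations, scalars, involution and unit. -/
structure IsPiecewiseHom {A B : Type u} [PiecewiseOps A] [PiecewiseOps B] (f : A → B) :
    Prop where
  map_comm : ∀ a b, Comm a b → Comm (f a) (f b)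
  map_mul : ∀ a b (h : Comm a b),
    f (PiecewiseOps.mul a b h) = PiecewiseOps.mul (f a) (f b) (map_comm a b h)
  map_add : ∀ a b (h : Comm a b),
    f (PiecewiseOps.add a b h) = PiecewiseOps.add (f a) (f b) (map_comm a b h)
  map_smul : ∀ (z : ℂ) a, f (z • a) = z • f a
  map_star : ∀ a, f (star a) = star (f a)
  map_one : f 1 = 1

/-- The restriction of a piecewise homomorphism to projections. -/
def projMap {A B : Type u} [PiecewiseOps A] [PiecewiseOps B] {f : A → B}
    (hf : IsPiecewiseHom f) (p : Proj A) : Proj B :=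
  ⟨f p, by rw [← hf.map_star, p.2.1], by
    rw [← hf.map_mul _ _ (comm_refl (p : A)), p.2.2]⟩

theorem pairwiseCommProj_image {A B : Type u} [PiecewiseOps A] [PiecewiseOps B] {f : A → B}
    (hf : IsPiecewiseHom f) {X : Set (Proj A)} (hX : PairwiseCommProj X) :
    PairwiseCommProj (projMap hf '' X) := by
  rintro _ ⟨p, hp, rfl⟩ _ ⟨q, hq, rfl⟩
  exact hf.map_comm _ _ (hX p hp q hq)

/-- Morphisms of piecewise AW*-algebras. -/
structure IsPiecewiseAWHom {A B : Type u} [PiecewiseAWStar A] [PiecewiseAWStar B] (f : A → B) :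
    Prop extends IsPiecewiseHom f where
  map_sup : ∀ (X : Set (Proj A)) (hX : PairwiseCommProj X),
    projMap toIsPiecewiseHom (PiecewiseAWStar.sup X hX) =
      PiecewiseAWStar.sup (projMap toIsPiecewiseHom '' X)
        (pairwiseCommProj_image toIsPiecewiseHom hX)

theorem IsPiecewiseHom.id {A : Type u} [PiecewiseOps A] : IsPiecewiseHom (id : A → A) :=
  ⟨fun _ _ h => h, fun _ _ _ => rfl, fun _ _ _ => rfl, fun _ _ => rfl, fun _ => rfl, rfl⟩

theorem IsPiecewiseHom.comp {A B C : Type u} [PiecewiseOps A] [PiecewiseOps B] [PiecewiseOps C]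
    {g : B → C} {f : A → B} (hg : IsPiecewiseHom g) (hf : IsPiecewiseHom f) :
    IsPiecewiseHom (g ∘ f) where
  map_comm a b h := hg.map_comm _ _ (hf.map_comm a b h)
  map_mul a b h := by simp only [Function.comp_apply, hf.map_mul a b h, hg.map_mul]
  map_add a b h := by simp only [Function.comp_apply, hf.map_add a b h, hg.map_add]
  map_smul z a := by simp only [Function.comp_apply, hf.map_smul, hg.map_smul]
  map_star a := by simp only [Function.comp_apply, hf.map_star, hg.map_star]
  map_one := by simp only [Function.comp_apply, hf.map_one, hg.map_one]

theorem projMap_id {A : Type u} [PiecewiseOps A] :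
    projMap (IsPiecewiseHom.id (A := A)) = id := rfl

theorem projMap_comp {A B C : Type u} [PiecewiseOps A] [PiecewiseOps B] [PiecewiseOps C]
    {g : B → C} {f : A → B} (hg : IsPiecewiseHom g) (hf : IsPiecewiseHom f) :
    projMap (hg.comp hf) = projMap hg ∘ projMap hf := rfl

theorem IsPiecewiseAWHom.id {A : Type u} [PiecewiseAWStar A] :
    IsPiecewiseAWHom (id : A → A) where
  toIsPiecewiseHom := IsPiecewiseHom.id
  map_sup X hX := by
    simp only [projMap_id, Set.image_id]
    rfl

theorem IsPiecewiseAWHom.comp {A B C : Type u} [PiecewiseAWStar A] [PiecewiseAWStar B]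
    [PiecewiseAWStar C] {g : B → C} {f : A → B} (hg : IsPiecewiseAWHom g)
    (hf : IsPiecewiseAWHom f) : IsPiecewiseAWHom (g ∘ f) where
  toIsPiecewiseHom := hg.toIsPiecewiseHom.comp hf.toIsPiecewiseHom
  map_sup X hX := by
    have h := congrArg (projMap hg.toIsPiecewiseHom) (hf.map_sup X hX)
    rw [hg.map_sup] at h
    simp only [← Set.image_comp] at h
    exact h

/-- The unitary elements of a piecewise algebra. -/
def unitaries (A : Type u) [PiecewiseOps A] : Set A :=
  {a | ∃ h : Comm a (star a), PiecewiseOps.mul a (star a) h = 1}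

/-- The elements `1 - 2p` for projections `p`. -/
def symmetries (A : Type u) [PiecewiseOps A] : Set A :=
  {s | ∃ (p : Proj A) (h : Comm (1 : A) ((-2 : ℂ) • (p : A))), s = PiecewiseOps.add _ _ h}

/-- The group `G`, regarded as a piecewise group with commuting elements as the commeasurable ones,
is a piecewise subgroup of the unitaries of `A`. -/
structure IsPiecewiseSubgroup {A : Type u} [PiecewiseOps A] (G : Set A) [Group G] : Prop where
  subset_unitaries : G ⊆ unitaries A
  comm_iff : ∀ g h : G, Comm (g : A) (h : A) ↔ g * h = h * g
  coe_mul : ∀ (g h : G) (hc : Comm (g : A) (h : A)),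
    ((g * h : G) : A) = PiecewiseOps.mul _ _ hc
  coe_one : ((1 : G) : A) = 1
  coe_inv : ∀ g : G, ((g⁻¹ : G) : A) = star (g : A)

/-! ### Complete orthomodular lattices -/

/-- Complete orthomodular lattices. -/
class CompleteOrthomodularLattice (P : Type u) extends CompleteLattice P, Compl P where
  compl_antitone : ∀ p q : P, p ≤ q → qᶜ ≤ pᶜ
  compl_involutive : ∀ p : P, pᶜᶜ = p
  sup_compl : ∀ p : P, p ⊔ pᶜ = ⊤
  inf_compl : ∀ p : P, p ⊓ pᶜ = ⊥
  orthomodular : ∀ p q : P, p ≤ q → p ⊔ (pᶜ ⊓ q) = q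

/-- Commeasurability in an orthomodular lattice: there are pairwise orthogonal `p'`, `q'`, `r` with
`p = p' ⊔ r` and `q = q' ⊔ r`. -/
def LatComm {P : Type u} [CompleteOrthomodularLattice P] (p q : P) : Prop :=
  ∃ p' q' r : P, p' ≤ q'ᶜ ∧ p' ≤ rᶜ ∧ q' ≤ rᶜ ∧ p = p' ⊔ r ∧ q = q' ⊔ r

/-- Morphisms of complete orthomodular lattices. -/
structure IsCOMLHom {P Q : Type u} [CompleteOrthomodularLattice P]
    [CompleteOrthomodularLattice Q] (f : P → Q) : Prop where
  map_compl : ∀ p, f pᶜ = (f p)ᶜ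
  map_sSup : ∀ S : Set P, f (sSup S) = sSup (f '' S)

theorem IsCOMLHom.id {P : Type u} [CompleteOrthomodularLattice P] :
    IsCOMLHom (id : P → P) :=
  ⟨fun _ => rfl, fun S => by simp⟩

theorem IsCOMLHom.comp {P Q R : Type u} [CompleteOrthomodularLattice P]
    [CompleteOrthomodularLattice Q] [CompleteOrthomodularLattice R] {g : Q → R} {f : P → Q}
    (hg : IsCOMLHom g) (hf : IsCOMLHom f) : IsCOMLHom (g ∘ f) :=
  ⟨fun p => by simp only [Function.comp_apply, hf.map_compl, hg.map_compl],
   fun S => by rw [Function.comp_apply, hf.map_sSup, hg.map_sSup, Set.image_comp]⟩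

theorem IsCOMLHom.map_sup {P Q : Type u} [CompleteOrthomodularLattice P]
    [CompleteOrthomodularLattice Q] {f : P → Q} (hf : IsCOMLHom f) (p q : P) :
    f (p ⊔ q) = f p ⊔ f q := by
  have h := hf.map_sSup {p, q}
  rwa [Set.image_pair, sSup_pair, sSup_pair] at h

theorem IsCOMLHom.monotone {P Q : Type u} [CompleteOrthomodularLattice P]
    [CompleteOrthomodularLattice Q] {f : P → Q} (hf : IsCOMLHom f) : Monotone f := by
  intro p q h
  rw [← sup_eq_right] at h ⊢
  rw [← hf.map_sup, h]

theorem IsCOMLHom.latComm {P Q : Type u} [CompleteOrthomodularLattice P]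
    [CompleteOrthomodularLattice Q] {f : P → Q} (hf : IsCOMLHom f) {p q : P}
    (h : LatComm p q) : LatComm (f p) (f q) := by
  obtain ⟨p', q', r, h1, h2, h3, rfl, rfl⟩ := h
  refine ⟨f p', f q', f r, ?_, ?_, ?_, hf.map_sup _ _, hf.map_sup _ _⟩
  · rw [← hf.map_compl]; exact hf.monotone h1
  · rw [← hf.map_compl]; exact hf.monotone h2
  · rw [← hf.map_compl]; exact hf.monotone h3

/-! ### The piecewise algebra `F(P)` of a complete orthomodular lattice -/

section FunctorF

variable {P Q R : Type u} [CompleteOrthomodularLattice P] [CompleteOrthomodularLattice Q]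
  [CompleteOrthomodularLattice R]

/-- A commeasurable complete Boolean subalgebra of `P`: a pairwise commeasurable subset closed
under complements and arbitrary suprema. -/
structure BoolSub (P : Type u) [CompleteOrthomodularLattice P] where
  carrier : Set P
  latComm : ∀ p ∈ carrier, ∀ q ∈ carrier, LatComm p q
  compl_mem : ∀ p ∈ carrier, pᶜ ∈ carrier
  sSup_mem : ∀ S : Set P, S ⊆ carrier → sSup S ∈ carrier

/-- The Stone space of a commeasurable complete Boolean subalgebra: its Boolean homomorphisms to
the two-element Boolean algebra, with the topology of pointwise convergence. -/
def Stone (C : BoolSub P) : Type u :=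
  {φ : C.carrier → Bool // (∀ p q : C.carrier, (q : P) = (p : P)ᶜ → φ q = !φ p) ∧
    ∀ p q r : C.carrier, (r : P) = (p : P) ⊔ (q : P) → φ r = (φ p || φ q)}

instance (C : BoolSub P) : TopologicalSpace (Stone C) :=
  inferInstanceAs (TopologicalSpace {_φ : C.carrier → Bool // _})

theorem Stone.continuous_eval {C : BoolSub P} (p : C.carrier) :
    Continuous fun φ : Stone C => φ.1 p :=
  (continuous_apply p).comp continuous_induced_dom

/-- The algebra of continuous complex functions on the Stone space. -/
abbrev Func (C : BoolSub P) : Type u := C(Stone C, ℂ)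

/-- Restriction of homomorphisms along an inclusion of subalgebras. -/
def stoneRes {C D : BoolSub P} (h : C.carrier ⊆ D.carrier) : C(Stone D, Stone C) where
  toFun φ := ⟨fun p => φ.1 ⟨p, h p.2⟩, fun p q e => φ.2.1 ⟨p, h p.2⟩ ⟨q, h q.2⟩ e,
    fun p q r e => φ.2.2 ⟨p, h p.2⟩ ⟨q, h q.2⟩ ⟨r, h r.2⟩ e⟩
  continuous_toFun := continuous_induced_rng.2
    (continuous_pi fun p : C.carrier => Stone.continuous_eval (⟨p, h p.2⟩ : D.carrier))

/-- `f ∈ Func C` is related to its image in `Func D` whenever `C ⊆ D`. -/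
def FRel (P : Type u) [CompleteOrthomodularLattice P] (x y : Σ C : BoolSub P, Func C) : Prop :=
  ∃ h : x.1.carrier ⊆ y.1.carrier, y.2 = x.2.comp (stoneRes h)

/-- The carrier of `F(P)`: the disjoint union of the algebras `Func C`, modulo the smallest
equivalence relation identifying functions with their images under inclusions `C ⊆ D`. -/
def F (P : Type u) [CompleteOrthomodularLattice P] : Type u := Quot (FRel P)

/-- The class of `f ∈ Func C` in `F(P)`. -/
def F.mk (C : BoolSub P) (f : Func C) : F P := Quot.mk _ ⟨C, f⟩

theorem latComm_bot_right (p : P) : LatComm p ⊥ :=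
  ⟨p, ⊥, ⊥, by
    have h : (⊥ : P)ᶜ = ⊤ := by
      have := CompleteOrthomodularLattice.sup_compl (⊥ : P)
      rwa [bot_sup_eq] at this
    simp [h]⟩

theorem latComm_symm {p q : P} (h : LatComm p q) : LatComm q p := by
  obtain ⟨p', q', r, h1, h2, h3, h4, h5⟩ := h
  refine ⟨q', p', r, ?_, h3, h2, h5, h4⟩
  have := CompleteOrthomodularLattice.compl_antitone _ _ h1
  rwa [CompleteOrthomodularLattice.compl_involutive] at this

theorem latComm_refl (p : P) : LatComm p p :=
  ⟨⊥, ⊥, p, by simp⟩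

theorem compl_bot' : (⊥ : P)ᶜ = ⊤ := by
  have := CompleteOrthomodularLattice.sup_compl (⊥ : P)
  rwa [bot_sup_eq] at this

theorem compl_top' : (⊤ : P)ᶜ = ⊥ := by
  rw [← compl_bot', CompleteOrthomodularLattice.compl_involutive]

/-- The smallest subalgebra `{⊥, ⊤}`. -/
def BoolSub.trivial (P : Type u) [CompleteOrthomodularLattice P] : BoolSub P where
  carrier := {⊥, ⊤}
  latComm := by
    rintro p (rfl | rfl) q (rfl | rfl)
    · exact latComm_refl _
    · exact latComm_symm (latComm_bot_right _)
    · exact latComm_bot_right _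
    · exact latComm_refl _
  compl_mem := by
    rintro p (rfl | rfl)
    · exact Or.inr compl_bot'
    · exact Or.inl compl_top'
  sSup_mem := by
    intro S hS
    by_cases h : (⊤ : P) ∈ S
    · exact Or.inr (top_le_iff.mp (le_sSup h))
    · refine Or.inl (le_bot_iff.mp (sSup_le fun b hb => ?_))
      rcases hS hb with rfl | rfl
      · exact le_rfl
      · exact absurd hb h

/-- The operations on `F(P)`. Two classes are commeasurable if they have representatives in a common
`Func C`, and are then added and multiplied by means of such representatives. The norm of a class
is the supremum norm of a representative. (The results do not depend on the representatives.) -/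
instance : PiecewiseOps (F P) where
  zero := F.mk (BoolSub.trivial P) 0
  one := F.mk (BoolSub.trivial P) 1
  star := Quot.map (fun x => ⟨x.1, star x.2⟩) (by
    rintro ⟨C, f⟩ ⟨D, g⟩ ⟨h, e⟩
    exact ⟨h, (congrArg (fun k => star k) e).trans rfl⟩)
  smul z := Quot.map (fun x => ⟨x.1, z • x.2⟩) (by
    rintro ⟨C, f⟩ ⟨D, g⟩ ⟨h, e⟩
    exact ⟨h, (congrArg (fun k => z • k) e).trans rfl⟩)
  norm x := ⨆ φ, ‖(Quot.out x).2 φ‖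
  Comm x y := ∃ (C : BoolSub P) (f g : Func C), x = F.mk C f ∧ y = F.mk C g
  comm_refl x := by
    obtain ⟨⟨C, f⟩, rfl⟩ := Quot.exists_rep x
    exact ⟨C, f, f, rfl, rfl⟩
  comm_symm := by
    rintro x y ⟨C, f, g, hf, hg⟩
    exact ⟨C, g, f, hg, hf⟩
  add x y h := F.mk h.choose (h.choose_spec.choose + h.choose_spec.choose_spec.choose)
  mul x y h := F.mk h.choose (h.choose_spec.choose * h.choose_spec.choose_spec.choose)

/-- The image of a commeasurable complete Boolean subalgebra under a morphism. -/
def BoolSub.map {f : P → Q} (hf : IsCOMLHom f) (C : BoolSub P) : BoolSub Q where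
  carrier := f '' C.carrier
  latComm := by
    rintro _ ⟨p, hp, rfl⟩ _ ⟨q, hq, rfl⟩
    exact hf.latComm (C.latComm p hp q hq)
  compl_mem := by
    rintro _ ⟨p, hp, rfl⟩
    exact ⟨pᶜ, C.compl_mem p hp, hf.map_compl p⟩
  sSup_mem := by
    intro S hS
    obtain ⟨S', hS', rfl⟩ := Set.subset_image_iff.mp hS
    exact ⟨sSup S', C.sSup_mem S' hS', hf.map_sSup S'⟩

/-- The map of Stone spaces induced by the restriction of a morphism to `C`. -/
def stoneMap {f : P → Q} (hf : IsCOMLHom f) (C : BoolSub P) :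
    C(Stone (C.map hf), Stone C) where
  toFun φ := ⟨fun p => φ.1 ⟨f p, p, p.2, rfl⟩,
    fun p q e => φ.2.1 ⟨f p, p, p.2, rfl⟩ ⟨f q, q, q.2, rfl⟩
      (by change f q = (f p)ᶜ; rw [e, hf.map_compl]),
    fun p q r e => φ.2.2 ⟨f p, p, p.2, rfl⟩ ⟨f q, q, q.2, rfl⟩ ⟨f r, r, r.2, rfl⟩
      (by change f r = f p ⊔ f q; rw [e, hf.map_sup])⟩
  continuous_toFun := continuous_induced_rng.2 (continuous_pi fun p : C.carrier =>
    Stone.continuous_eval (⟨f p, p, p.2, rfl⟩ : (C.map hf).carrier))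

/-- The map `F(f) : F(P) → F(Q)` induced by a morphism `f : P → Q`: on `Func C` it is the
homomorphism `Func C → Func (f '' C)` induced by the restriction of `f` to `C`. -/
def F.map {f : P → Q} (hf : IsCOMLHom f) : F P → F Q :=
  Quot.map (fun x => ⟨x.1.map hf, x.2.comp (stoneMap hf x.1)⟩) (by
    rintro ⟨C, g⟩ ⟨D, g'⟩ ⟨h, e⟩
    exact ⟨Set.image_mono h,
      (congrArg (fun k : Func D => k.comp (stoneMap hf D)) e).trans rfl⟩)

theorem F.map_id (x : F P) : F.map (IsCOMLHom.id (P := P)) x = x := by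
  obtain ⟨⟨C, g⟩, rfl⟩ := Quot.exists_rep x
  refine (Quot.sound ⟨?_, ?_⟩).symm
  · intro p hp
    exact ⟨p, hp, rfl⟩
  · rfl

theorem F.map_comp {g : Q → R} {f : P → Q} (hg : IsCOMLHom g) (hf : IsCOMLHom f) (x : F P) :
    F.map (hg.comp hf) x = F.map hg (F.map hf x) := by
  obtain ⟨⟨C, h⟩, rfl⟩ := Quot.exists_rep x
  refine Quot.sound ⟨?_, ?_⟩
  · rintro _ ⟨p, hp, rfl⟩
    exact ⟨f p, ⟨p, hp, rfl⟩, rfl⟩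
  · rfl

end FunctorF

/-! ### Extended piecewise AW*-algebras -/

/-- Extended piecewise AW*-algebras `(A, P, G, ·)`. Here `P` is a complete orthomodular lattice
structure on `Proj A` whose underlying piecewise complete Boolean algebra (commeasurability,
complement, suprema of commeasurable sets) is that of `Proj A`. -/
structure ExtPiecewiseAWStar : Type (u + 1) where
  A : Type u
  [piecewise : PiecewiseAWStar A]
  [lattice : CompleteOrthomodularLattice (Proj A)]
  latComm_iff : ∀ p q : Proj A, LatComm p q ↔ Comm (p : A) (q : A)
  coe_compl : ∀ p : Proj A, ∃ h : Comm (1 : A) ((-1 : ℂ) • (p : A)),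
    ((pᶜ : Proj A) : A) = PiecewiseOps.add _ _ h
  sSup_eq : ∀ (X : Set (Proj A)) (hX : PairwiseCommProj X), sSup X = PiecewiseAWStar.sup X hX
  G : Set A
  [group : Group G]
  isPiecewiseSubgroup : IsPiecewiseSubgroup G
  symmetries_subset : symmetries A ⊆ G
  closure_symmetries : Subgroup.closure {g : G | (g : A) ∈ symmetries A} = ⊤
  act : G →* Equiv.Perm A
  act_isHom : ∀ g, IsPiecewiseAWHom (act g)
  act_conj : ∀ g h : G, act g (h : A) = ((g * h * g⁻¹ : G) : A)

attribute [instance] ExtPiecewiseAWStar.piecewise ExtPiecewiseAWStar.lattice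
  ExtPiecewiseAWStar.group

/-- Morphisms of extended piecewise AW*-algebras. -/
@[ext]
structure ExtPiecewiseAWStar.Hom (X Y : ExtPiecewiseAWStar.{u}) : Type u where
  toFun : X.A → Y.A
  isHom : IsPiecewiseAWHom toFun
  isCOMLHom : IsCOMLHom (projMap isHom.toIsPiecewiseHom)
  group_equivariant : ∃ φ : X.G →* Y.G, (∀ g : X.G, (φ g : Y.A) = toFun g) ∧
    ∀ (u : X.G) (a : X.A), toFun (X.act u a) = Y.act (φ u) (toFun a)

instance : Category.{u} ExtPiecewiseAWStar.{u} where
  Hom := ExtPiecewiseAWStar.Hom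
  id X := ⟨id, IsPiecewiseAWHom.id, IsCOMLHom.id, MonoidHom.id _, fun _ => rfl, fun _ _ => rfl⟩
  comp f g := ⟨g.toFun ∘ f.toFun, g.isHom.comp f.isHom, g.isCOMLHom.comp f.isCOMLHom, by
    obtain ⟨φ, h1, h2⟩ := f.group_equivariant
    obtain ⟨ψ, h3, h4⟩ := g.group_equivariant
    refine ⟨ψ.comp φ, fun x => ?_, fun u a => ?_⟩
    · simp only [MonoidHom.comp_apply, Function.comp_apply, h3, h1]
    · simp only [MonoidHom.comp_apply, Function.comp_apply, h2, h4]⟩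

/-! ### Active lattices -/

/-- Active lattices `(P, G, ·)`. -/
structure ActiveLattice : Type (u + 1) where
  P : Type u
  [lattice : CompleteOrthomodularLattice P]
  G : Set (F P)
  [group : Group G]
  isPiecewiseSubgroup : IsPiecewiseSubgroup G
  symmetries_subset : symmetries (F P) ⊆ G
  closure_symmetries : Subgroup.closure {g : G | (g : F P) ∈ symmetries (F P)} = ⊤
  act : G →* Equiv.Perm P
  act_isHom : ∀ g, IsCOMLHom (act g)
  act_conj : ∀ g h : G, F.map (act_isHom g) (h : F P) = ((g * h * g⁻¹ : G) : F P)

attribute [instance] ActiveLattice.lattice ActiveLattice.group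

/-- Morphisms of active lattices. -/
@[ext]
structure ActiveLattice.Hom (X Y : ActiveLattice.{u}) : Type u where
  toFun : X.P → Y.P
  isHom : IsCOMLHom toFun
  group_equivariant : ∃ φ : X.G →* Y.G, (∀ g : X.G, (φ g : F Y.P) = F.map isHom g) ∧
    ∀ (u : X.G) (p : X.P), toFun (X.act u p) = Y.act (φ u) (toFun p)

instance : Category.{u} ActiveLattice.{u} where
  Hom := ActiveLattice.Hom
  id X := ⟨id, IsCOMLHom.id, MonoidHom.id _, fun g => (F.map_id (g : F X.P)).symm,
    fun _ _ => rfl⟩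
  comp f g := ⟨g.toFun ∘ f.toFun, g.isHom.comp f.isHom, by
    obtain ⟨φ, h1, h2⟩ := f.group_equivariant
    obtain ⟨ψ, h3, h4⟩ := g.group_equivariant
    refine ⟨ψ.comp φ, fun x => ?_, fun u p => ?_⟩
    · rw [MonoidHom.comp_apply, h3, h1]
      exact (F.map_comp g.isHom f.isHom _).symm
    · simp only [MonoidHom.comp_apply, Function.comp_apply, h2, h4]⟩

end

end ActiveLattices

namespace ActiveLattices

noncomputable section

open PiecewiseOps (Comm comm_refl comm_symm)

/-! ### Commeasurability in orthomodular lattices -/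

section Orthomodular

variable {P Q : Type u} [CompleteOrthomodularLattice P] [CompleteOrthomodularLattice Q]

/-! A piecewise AW*-algebra is determined by its projections, because a commutative AW*-algebra is
the algebra of continuous functions on the Stone space of its complete Boolean algebra of
projections. The equivalence sends an active lattice `(P, G, ·)` to `F P` with its lattice of
projections, the same group, and the action induced on `F P` by functoriality. It is shown to be
full, faithful and essentially surjective.

The first task is to control the colimit `F P`. Its equivalence relation is only generated by
inclusions, so an invariant is needed to recognise equal classes. To `f ∈ Func C` and an open `U ⊆
ℂ` one attaches `specElem C f U ∈ C`, the supremum of the elements on whose clopen set `f` lies in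
`U`. These elements do not change when `C` is enlarged, they determine `f`, and `f` descends to any
smaller subalgebra containing them all. Hence equal classes have a common representative on the
intersection of their subalgebras (`F.exists_inter_of_mk_eq`), the operations are well defined,
`Proj (F P)` is `P`, and bicommutants of spectral elements give the coherent choice of commutative
AW*-algebras.

The second task is to map out of `F P`. A `*`-homomorphism on `Func C` is determined by its values
on the characteristic functions `chi p`, and any Boolean homomorphism into projections extends
(Stone-Weierstrass and Gelfand duality). Coherence of the assignment `T` in the target makes such
extensions for different `C` compatible. This gives `F.hom_ext`, which yields fullness and all
naturality statements, and the map `toAlgebra : F (Proj A) → A`. That map is bijective and reflects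
commeasurability, because projections generate a commutative AW*-algebra. Transporting the group
along it gives essential surjectivity. -/

theorem oml_compl_compl (p : P) : pᶜᶜ = p := CompleteOrthomodularLattice.compl_involutive p

theorem oml_compl_le {p q : P} : pᶜ ≤ qᶜ ↔ q ≤ p := by
  refine ⟨fun h => ?_, CompleteOrthomodularLattice.compl_antitone q p⟩
  have := CompleteOrthomodularLattice.compl_antitone _ _ h
  rwa [oml_compl_compl, oml_compl_compl] at this

theorem oml_le_compl {p q : P} : p ≤ qᶜ ↔ q ≤ pᶜ := by
  rw [← oml_compl_le, oml_compl_compl]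

theorem oml_compl_sup (p q : P) : (p ⊔ q)ᶜ = pᶜ ⊓ qᶜ := by
  apply le_antisymm
  · exact le_inf (oml_compl_le.2 le_sup_left) (oml_compl_le.2 le_sup_right)
  · rw [oml_le_compl]
    exact sup_le (oml_le_compl.1 inf_le_left) (oml_le_compl.1 inf_le_right)

theorem oml_compl_inf (p q : P) : (p ⊓ q)ᶜ = pᶜ ⊔ qᶜ := by
  rw [← oml_compl_compl (pᶜ ⊔ qᶜ), oml_compl_sup, oml_compl_compl, oml_compl_compl]

/-- In a decomposition, `r` lies below `p ⊓ q` and `p'` below `p ⊓ qᶜ`. Conversely, the orthomodular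
law always splits `q` along `p ⊓ q ≤ q`, so only the splitting of `p` is a condition. In this
one-sided form, stability under complements and suprema is immediate. -/
theorem latComm_iff_eq {p q : P} : LatComm p q ↔ p = (p ⊓ q) ⊔ (p ⊓ qᶜ) := by
  constructor
  · rintro ⟨p', q', r, h1, h2, h3, rfl, rfl⟩
    refine le_antisymm (sup_le ?_ ?_) (sup_le inf_le_left inf_le_left)
    · refine le_sup_of_le_right (le_inf le_sup_left ?_)
      rw [oml_compl_sup]
      exact le_inf h1 h2
    · exact le_sup_of_le_left (le_inf le_sup_right le_sup_right)
  · intro h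
    refine ⟨p ⊓ qᶜ, q ⊓ (p ⊓ q)ᶜ, p ⊓ q, ?_, ?_, inf_le_right, ?_, ?_⟩
    · exact inf_le_right.trans (oml_compl_le.2 inf_le_left)
    · exact inf_le_right.trans (oml_compl_le.2 inf_le_right)
    · rwa [sup_comm]
    · rw [sup_comm, inf_comm q]
      exact (CompleteOrthomodularLattice.orthomodular (p ⊓ q) q inf_le_right).symm

theorem LatComm.compl_right {p q : P} (h : LatComm p q) : LatComm p qᶜ := by
  rw [latComm_iff_eq] at h ⊢
  rwa [oml_compl_compl, sup_comm]

theorem latComm_of_le {p q : P} (h : p ≤ q) : LatComm p q := by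
  rw [latComm_iff_eq, inf_eq_left.2 h]
  exact (sup_eq_left.2 inf_le_left).symm

theorem LatComm.sSup_right {p : P} {S : Set P} (h : ∀ q ∈ S, LatComm p q) :
    LatComm p (sSup S) := by
  apply latComm_symm
  rw [latComm_iff_eq]
  refine le_antisymm (sSup_le fun q hq => ?_) (sup_le inf_le_left inf_le_left)
  rw [latComm_iff_eq.1 (latComm_symm (h q hq))]
  exact sup_le_sup (inf_le_inf_right _ (le_sSup hq)) (inf_le_inf_right _ (le_sSup hq))

/-- Proved in the dual form `key`: since `qᶜ` splits along `p`, it is the join of `p ⊓ qᶜ` and an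
element below `pᶜ`. -/
theorem LatComm.inf_compl_sup {p q : P} (h : LatComm p q) : p ⊓ (pᶜ ⊔ q) = p ⊓ q := by
  have key : pᶜ ⊔ (p ⊓ qᶜ) = pᶜ ⊔ qᶜ := by
    refine le_antisymm (sup_le_sup_left inf_le_right _) (sup_le le_sup_left ?_)
    refine (latComm_iff_eq.1 (latComm_symm h.compl_right)).le.trans ?_
    refine sup_le (le_sup_of_le_right ?_) (le_sup_of_le_left inf_le_right)
    rw [inf_comm]
  have := congrArg (·ᶜ) key
  simpa only [oml_compl_sup, oml_compl_inf, oml_compl_compl] using this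

/-- An element distributes over a supremum of elements commeasurable with it. -/
theorem LatComm.inf_sSup {p : P} {S : Set P} (h : ∀ q ∈ S, LatComm p q) :
    p ⊓ sSup S = sSup ((p ⊓ ·) '' S) := by
  have hle : sSup ((p ⊓ ·) '' S) ≤ p ⊓ sSup S := by
    refine sSup_le ?_
    rintro _ ⟨q, hq, rfl⟩
    exact inf_le_inf_left _ (le_sSup hq)
  -- By the orthomodular law it suffices that the part of `p ⊓ sSup S` orthogonal to the right-hand
  -- side vanishes. It lies below `sSup S`, and for each `q ∈ S` below `p ⊓ (p ⊓ q)ᶜ = p ⊓ qᶜ`,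
  -- hence also below `(sSup S)ᶜ`.
  rw [← CompleteOrthomodularLattice.orthomodular _ _ hle]
  refine sup_eq_left.2 (le_trans (le_of_eq ?_) bot_le)
  rw [← le_bot_iff, ← CompleteOrthomodularLattice.inf_compl (sSup S)]
  refine le_inf (inf_le_right.trans inf_le_right) ?_
  rw [oml_le_compl]
  refine sSup_le fun q hq => ?_
  rw [oml_le_compl]
  calc (sSup ((p ⊓ ·) '' S))ᶜ ⊓ (p ⊓ sSup S) ≤ p ⊓ (p ⊓ q)ᶜ :=
        le_inf (inf_le_right.trans inf_le_left)
          (inf_le_left.trans (oml_compl_le.2 (le_sSup ⟨q, hq, rfl⟩)))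
    _ = p ⊓ qᶜ := by rw [oml_compl_inf, (h q hq).compl_right.inf_compl_sup]
    _ ≤ qᶜ := inf_le_right

theorem LatComm.inf_sup {p q r : P} (hq : LatComm p q) (hr : LatComm p r) :
    p ⊓ (q ⊔ r) = (p ⊓ q) ⊔ (p ⊓ r) := by
  have h : ∀ x ∈ ({q, r} : Set P), LatComm p x := by
    rintro x (rfl | rfl) <;> assumption
  have := LatComm.inf_sSup h
  rwa [Set.image_pair, sSup_pair, sSup_pair] at this

/-- The elements commeasurable with every element of `X`. -/
def commutant (X : Set P) : Set P := {p | ∀ q ∈ X, LatComm p q}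

theorem commutant_anti {X Y : Set P} (h : X ⊆ Y) : commutant Y ⊆ commutant X :=
  fun _ hp q hq => hp q (h hq)

theorem subset_commutant_commutant (X : Set P) : X ⊆ commutant (commutant X) :=
  fun _ hp _ hq => latComm_symm (hq _ hp)

/-- The commeasurable complete Boolean subalgebra generated by a pairwise commeasurable set. -/
def BoolSub.gen (X : Set P) (hX : ∀ p ∈ X, ∀ q ∈ X, LatComm p q) : BoolSub P where
  carrier := commutant (commutant X)
  -- Pairwise commeasurability says that `X` lies in its commutant, so the bicommutant lies in the
  -- commutant as well.
  latComm _ hp q hq := hp q (commutant_anti (fun x hx => hX x hx) hq)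
  compl_mem _ hp q hq := latComm_symm (latComm_symm (hp q hq)).compl_right
  sSup_mem _ hS q hq := latComm_symm (LatComm.sSup_right fun _ hp => latComm_symm (hS hp q hq))

/-! ### Commeasurable subalgebras as Boolean algebras. -/

namespace BoolSub

variable (C : BoolSub P)

theorem bot_mem : ⊥ ∈ C.carrier := by
  simpa using C.sSup_mem ∅ (Set.empty_subset _)

theorem top_mem : ⊤ ∈ C.carrier := compl_bot' (P := P) ▸ C.compl_mem _ C.bot_mem

variable {C}

theorem sup_mem {p q : P} (hp : p ∈ C.carrier) (hq : q ∈ C.carrier) : p ⊔ q ∈ C.carrier := by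
  rw [← sSup_pair]
  exact C.sSup_mem _ (by rintro x (rfl | rfl) <;> assumption)

theorem inf_mem {p q : P} (hp : p ∈ C.carrier) (hq : q ∈ C.carrier) : p ⊓ q ∈ C.carrier := by
  rw [← oml_compl_compl (p ⊓ q), oml_compl_inf]
  exact C.compl_mem _ (sup_mem (C.compl_mem _ hp) (C.compl_mem _ hq))

/-- The intersection of two subalgebras. -/
def inter (C D : BoolSub P) : BoolSub P where
  carrier := C.carrier ∩ D.carrier
  latComm p hp q hq := C.latComm p hp.1 q hq.1
  compl_mem p hp := ⟨C.compl_mem p hp.1, D.compl_mem p hp.2⟩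
  sSup_mem S hS := ⟨C.sSup_mem S (hS.trans Set.inter_subset_left),
    D.sSup_mem S (hS.trans Set.inter_subset_right)⟩

theorem inter_subset_left {C D : BoolSub P} : (C.inter D).carrier ⊆ C.carrier :=
  Set.inter_subset_left

theorem inter_subset_right {C D : BoolSub P} : (C.inter D).carrier ⊆ D.carrier :=
  Set.inter_subset_right

/-- The subalgebra generated by one element. -/
def single (p : P) : BoolSub P :=
  gen {p} (by rintro _ rfl _ rfl; exact latComm_refl _)

theorem mem_single (p : P) : p ∈ (single p).carrier := subset_commutant_commutant _ rfl

instance : Lattice C.carrier where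
  sup p q := ⟨p ⊔ q, sup_mem p.2 q.2⟩
  inf p q := ⟨p ⊓ q, inf_mem p.2 q.2⟩
  le_sup_left p _ := le_sup_left (a := (p : P))
  le_sup_right p _ := le_sup_right (a := (p : P))
  sup_le _ _ _ h h' := sup_le (α := P) h h'
  inf_le_left p _ := inf_le_left (a := (p : P))
  inf_le_right p _ := inf_le_right (a := (p : P))
  le_inf _ _ _ h h' := le_inf (α := P) h h'

instance : BooleanAlgebra C.carrier where
  __ := (inferInstance : Lattice C.carrier)
  le_sup_inf p q r := by
    change ((p : P) ⊔ q) ⊓ ((p : P) ⊔ r) ≤ (p : P) ⊔ ((q : P) ⊓ r)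
    have h : ∀ a b : C.carrier, LatComm (a : P) b := fun a b => C.latComm _ a.2 _ b.2
    have h₁ : LatComm ((p : P) ⊔ q) p := h (p ⊔ q) p
    have h₂ : LatComm ((p : P) ⊔ q) r := h (p ⊔ q) r
    rw [h₁.inf_sup h₂, inf_comm _ (r : P)]
    refine sup_le (le_sup_of_le_left inf_le_right) ?_
    refine ((h r p).inf_sup (h r q)).le.trans (sup_le (le_sup_of_le_left inf_le_right) ?_)
    rw [inf_comm]
    exact le_sup_right
  compl p := ⟨(p : P)ᶜ, C.compl_mem _ p.2⟩
  top := ⟨⊤, C.top_mem⟩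
  bot := ⟨⊥, C.bot_mem⟩
  inf_compl_le_bot p := (CompleteOrthomodularLattice.inf_compl (p : P)).le
  top_le_sup_compl p := (CompleteOrthomodularLattice.sup_compl (p : P)).ge
  le_top p := le_top (α := P)
  bot_le p := bot_le (α := P)

end BoolSub

/-! ### Stone spaces -/

namespace Stone

variable {C D : BoolSub P}

theorem map_compl (φ : Stone C) (p : C.carrier) : φ.1 pᶜ = !φ.1 p := φ.2.1 p pᶜ rfl

theorem map_sup (φ : Stone C) (p q : C.carrier) : φ.1 (p ⊔ q) = (φ.1 p || φ.1 q) :=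
  φ.2.2 p q _ rfl

theorem map_top (φ : Stone C) : φ.1 ⊤ = true := by
  rw [← sup_compl_eq_top (x := (⊥ : C.carrier)), map_sup, map_compl, Bool.or_not_self]

theorem map_bot (φ : Stone C) : φ.1 ⊥ = false := by
  rw [← compl_top, map_compl, map_top, Bool.not_true]

theorem map_inf (φ : Stone C) (p q : C.carrier) : φ.1 (p ⊓ q) = (φ.1 p && φ.1 q) := by
  rw [← compl_compl (p ⊓ q), compl_inf, map_compl, map_sup, map_compl, map_compl]
  simp

theorem map_mono (φ : Stone C) {p q : C.carrier} (h : p ≤ q) (hp : φ.1 p = true) :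
    φ.1 q = true := by
  rw [← sup_eq_right.2 h, map_sup, hp, Bool.true_or]

@[ext] theorem ext {φ ψ : Stone C} (h : ∀ p, φ.1 p = ψ.1 p) : φ = ψ :=
  Subtype.ext (funext h)

/-- The basic clopen subset of the Stone space given by an element. -/
def basic (p : C.carrier) : Set (Stone C) := {φ | φ.1 p = true}

theorem isClosed_range : IsClosed {φ : C.carrier → Bool |
    (∀ p q : C.carrier, (q : P) = (p : P)ᶜ → φ q = !φ p) ∧
    ∀ p q r : C.carrier, (r : P) = (p : P) ⊔ (q : P) → φ r = (φ p || φ q)} := by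
  have hc : ∀ p : C.carrier, Continuous fun φ : C.carrier → Bool => φ p := continuous_apply
  have h₁ : IsClosed {φ : C.carrier → Bool |
      ∀ p q : C.carrier, (q : P) = (p : P)ᶜ → φ q = !φ p} := by
    simp only [Set.ofPred_forall]
    refine isClosed_iInter fun p => isClosed_iInter fun q => isClosed_iInter fun _ =>
      isClosed_eq (hc q) ((continuous_of_discreteTopology (f := Bool.not)).comp (hc p))
  have h₂ : IsClosed {φ : C.carrier → Bool |
      ∀ p q r : C.carrier, (r : P) = (p : P) ⊔ (q : P) → φ r = (φ p || φ q)} := by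
    simp only [Set.ofPred_forall]
    refine isClosed_iInter fun p => isClosed_iInter fun q => isClosed_iInter fun r =>
      isClosed_iInter fun _ => isClosed_eq (hc r) ?_
    exact (continuous_of_discreteTopology (f := fun x : Bool × Bool => x.1 || x.2)).comp
      ((hc p).prodMk (hc q))
  exact h₁.inter h₂

instance : CompactSpace (Stone C) :=
  isCompact_iff_compactSpace.1 (isClosed_range (C := C)).isCompact

instance : T2Space (Stone C) := inferInstanceAs (T2Space {_φ : C.carrier → Bool // _})

/-- Points of the Stone space are indicator functions of complements of prime ideals. The principal
filter of a nonzero `p` misses the ideal `{⊥}`, so the prime ideal theorem provides a prime ideal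
avoiding `p`. -/
theorem exists_of_ne_bot {p : C.carrier} (hp : p ≠ ⊥) : ∃ φ : Stone C, φ.1 p = true := by
  classical
  obtain ⟨J, hJ, -, hd⟩ := DistribLattice.prime_ideal_of_disjoint_filter_ideal
    (F := Order.PFilter.principal p) (I := Order.Ideal.principal (⊥ : C.carrier)) (by
      rw [Set.disjoint_left]
      intro x hx hx'
      exact hp (le_bot_iff.1 (le_trans (Order.PFilter.mem_principal.1 hx)
        (Order.Ideal.mem_principal.1 hx'))))
  refine ⟨⟨fun q => decide (q ∉ J), fun a b e => ?_, fun a b c e => ?_⟩, ?_⟩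
  · obtain rfl : b = aᶜ := Subtype.ext e
    have h1 : a ∈ J ∨ aᶜ ∈ J := hJ.mem_or_compl_mem
    have h2 : ¬ (a ∈ J ∧ aᶜ ∈ J) := fun h => hJ.toIsProper.top_notMem (by
      rw [← sup_compl_eq_top (x := a)]; exact J.sup_mem h.1 h.2)
    by_cases ha : a ∈ J <;> by_cases hb : aᶜ ∈ J <;> simp_all
  · obtain rfl : c = a ⊔ b := Subtype.ext e
    by_cases ha : a ∈ J <;> by_cases hb : b ∈ J <;> simp [ha, hb]
  · simp only [decide_eq_true_eq]
    exact fun h => Set.disjoint_left.1 hd (Order.PFilter.mem_principal.2 le_rfl) h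

theorem le_of_basic_subset {p q : C.carrier} (h : basic p ⊆ basic q) : p ≤ q := by
  rw [← disjoint_compl_right_iff, disjoint_iff]
  by_contra hne
  obtain ⟨φ, hφ⟩ := exists_of_ne_bot hne
  rw [map_inf, map_compl, Bool.and_eq_true] at hφ
  have : φ.1 q = true := h hφ.1
  simp [this] at hφ

/-- Every point has a neighbourhood basis of basic clopen sets. -/
theorem exists_basic_subset {φ : Stone C} {U : Set (Stone C)} (hU : IsOpen U) (h : φ ∈ U) :
    ∃ p, φ ∈ basic p ∧ basic p ⊆ U := by
  obtain ⟨V, hV, rfl⟩ := isOpen_induced_iff.1 hU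
  obtain ⟨I, u, hu, hI⟩ := isOpen_pi_iff.1 hV φ.1 h
  refine ⟨I.inf fun i => if φ.1 i = true then i else iᶜ, ?_, fun ψ hψ => hI fun i hi => ?_⟩
  · change φ.1 _ = true
    clear hu hI
    induction I using Finset.cons_induction with
    | empty => exact map_top φ
    | cons i I hi ih =>
      rw [Finset.inf_cons, map_inf, ih, Bool.and_true]
      by_cases h : φ.1 i = true
      · rw [if_pos h, h]
      · rw [if_neg h, map_compl]
        simpa using h
  · have hle := map_mono ψ (Finset.inf_le (f := fun i => if φ.1 i = true then i else iᶜ) hi) hψ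
    have : ψ.1 i = φ.1 i := by
      by_cases h : φ.1 i = true
      · rw [if_pos h] at hle
        rw [h, hle]
      · rw [if_neg h, map_compl] at hle
        simp_all
    rw [this]
    exact (hu i hi).2

/-- The image is compact, hence closed. A missed point would have a basic neighbourhood, given by a
nonzero `p ∈ C`, that is disjoint from the image. But `p` is still nonzero in `D`, so some point of
`Stone D` restricts into that neighbourhood. -/
theorem stoneRes_surjective (h : C.carrier ⊆ D.carrier) : Function.Surjective (stoneRes h) := by
  intro φ
  by_contra hφ
  have hcl : IsClosed (Set.range (stoneRes h)) :=
    (isCompact_range (stoneRes h).continuous).isClosed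
  obtain ⟨p, hp, hsub⟩ := exists_basic_subset hcl.isOpen_compl (show φ ∈ _ from hφ)
  have hne : (⟨p, h p.2⟩ : D.carrier) ≠ ⊥ := by
    intro e
    have : p = ⊥ := Subtype.ext (show (p : P) = ⊥ from congrArg (fun x : D.carrier => (x : P)) e)
    rw [this] at hp
    exact absurd (map_bot φ) (by rw [hp]; decide)
  obtain ⟨ψ, hψ⟩ := exists_of_ne_bot hne
  exact hsub (show stoneRes h ψ ∈ basic p from hψ) ⟨ψ, rfl⟩

end Stone

end Orthomodular

/-! ### The spectral invariant of elements of `F(P)` -/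

section SpectralInvariant

open TopologicalSpace (Opens)

variable {P Q : Type u} [CompleteOrthomodularLattice P] [CompleteOrthomodularLattice Q]
  {C D E : BoolSub P}

/-- The characteristic function of a basic clopen set. -/
def chi (p : C.carrier) : Func C where
  toFun φ := if φ.1 p = true then 1 else 0
  continuous_toFun := (continuous_of_discreteTopology
    (f := fun b : Bool => if b = true then (1 : ℂ) else 0)).comp (Stone.continuous_eval p)

theorem chi_apply (p : C.carrier) (φ : Stone C) : chi p φ = if φ.1 p = true then 1 else 0 := rfl

theorem star_chi (p : C.carrier) : star (chi p) = chi p := by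
  ext φ
  simp only [ContinuousMap.star_apply, chi_apply]
  split_ifs <;> simp

theorem chi_mul_chi (p q : C.carrier) : chi p * chi q = chi (p ⊓ q) := by
  ext φ
  simp only [ContinuousMap.mul_apply, chi_apply, Stone.map_inf, Bool.and_eq_true]
  split_ifs <;> simp_all

theorem chi_mul_self (p : C.carrier) : chi p * chi p = chi p := by rw [chi_mul_chi, inf_idem]

theorem chi_compl (p : C.carrier) : chi pᶜ = 1 - chi p := by
  ext φ
  simp only [ContinuousMap.sub_apply, ContinuousMap.one_apply, chi_apply, Stone.map_compl]
  cases φ.1 p <;> simp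

theorem chi_sup (p q : C.carrier) : chi (p ⊔ q) = chi p + chi q - chi p * chi q := by
  ext φ
  simp only [ContinuousMap.sub_apply, ContinuousMap.add_apply, ContinuousMap.mul_apply, chi_apply,
    Stone.map_sup]
  cases φ.1 p <;> cases φ.1 q <;> simp

/-- The supremum of the elements on whose basic clopen set `f` takes values in `U`. -/
def specElem (C : BoolSub P) (f : Func C) (U : Opens ℂ) : P :=
  sSup {p | ∃ hp : p ∈ C.carrier, ∀ φ : Stone C, φ.1 ⟨p, hp⟩ = true → f φ ∈ U}

theorem specElem_mem (f : Func C) (U : Opens ℂ) : specElem C f U ∈ C.carrier :=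
  C.sSup_mem _ fun _ hp => hp.1

/-- The open set `f ⁻¹' U` is a union of basic clopen sets. Only this implication is available: the
clopen set of the supremum may be larger than the preimage. -/
theorem specElem_apply {f : Func C} {U : Opens ℂ} {φ : Stone C} (h : f φ ∈ U) :
    φ.1 ⟨specElem C f U, specElem_mem f U⟩ = true := by
  obtain ⟨p, hp, hsub⟩ := Stone.exists_basic_subset (U.isOpen.preimage f.continuous) h
  exact φ.map_mono (le_sSup (α := P) ⟨p.2, fun ψ hψ => hsub hψ⟩) hp

/-- Enlarging the subalgebra adds clopen sets inside the preimage of `U`, but each of them is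
already dominated by the supremum formed in `C`. This invariance under the generating relation is
what lets the element pass to `F P`. -/
theorem specElem_comp_stoneRes (h : C.carrier ⊆ D.carrier) (f : Func C) (U : Opens ℂ) :
    specElem D (f.comp (stoneRes h)) U = specElem C f U := by
  refine le_antisymm (sSup_le ?_) (sSup_le ?_)
  · rintro q ⟨hq, hqU⟩
    refine Stone.le_of_basic_subset (p := ⟨q, hq⟩) (q := ⟨_, h (specElem_mem f U)⟩) fun ψ hψ => ?_
    exact specElem_apply (φ := stoneRes h ψ) (hqU ψ hψ)
  · rintro p ⟨hp, hpU⟩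
    exact le_sSup ⟨h hp, fun φ hφ => hpU (stoneRes h φ) hφ⟩

theorem specElem_le_compl (f : Func C) {U V : Opens ℂ} (h : Disjoint (U : Set ℂ) V) :
    specElem C f U ≤ (specElem C f V)ᶜ := by
  refine sSup_le ?_
  rintro p ⟨hp, hpU⟩
  rw [oml_le_compl]
  refine sSup_le ?_
  rintro q ⟨hq, hqV⟩
  refine Stone.le_of_basic_subset (p := ⟨q, hq⟩) (q := (⟨p, hp⟩ : C.carrier)ᶜ) fun φ hφ => ?_
  change φ.1 _ = true
  rw [Stone.map_compl, Bool.not_eq_true', ← Bool.not_eq_true]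
  exact fun hφ' => Set.disjoint_left.1 h (hpU φ hφ') (hqV φ hφ)

/-- Distinct values have disjoint open neighbourhoods, whose spectral elements are orthogonal. The
point `ψ` would then be true on two orthogonal elements. -/
theorem apply_eq_apply_of_specElem {f : Func C} {g : Func D} {φ : Stone C} {ψ : Stone D}
    (h : ∀ U : Opens ℂ, φ.1 ⟨specElem C f U, specElem_mem f U⟩ = true →
      ψ.1 ⟨specElem D g U, specElem_mem g U⟩ = true) : f φ = g ψ := by
  by_contra hne
  obtain ⟨U, V, hU, hV, hfU, hgV, hd⟩ := t2_separation hne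
  have h₁ := h ⟨U, hU⟩ (specElem_apply hfU)
  have h₂ := specElem_apply (U := ⟨V, hV⟩) hgV
  have h₃ := ψ.map_mono (q := (⟨specElem D g ⟨V, hV⟩, specElem_mem g _⟩ : D.carrier)ᶜ)
    (specElem_le_compl g (U := ⟨U, hU⟩) (V := ⟨V, hV⟩) hd) h₁
  rw [Stone.map_compl, h₂] at h₃
  simp at h₃

theorem eq_of_specElem {f g : Func C} (h : ∀ U, specElem C f U = specElem C g U) : f = g := by
  ext φ
  refine apply_eq_apply_of_specElem fun U hU => ?_
  simpa only [h U] using hU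

/-- A function descends to a smaller subalgebra if its spectral invariant lies in it. -/
theorem exists_comp_stoneRes (h : C.carrier ⊆ D.carrier) (f : Func D)
    (hf : ∀ U, specElem D f U ∈ C.carrier) : ∃ g : Func C, f = g.comp (stoneRes h) := by
  have hq : Topology.IsQuotientMap (stoneRes h) :=
    Topology.IsQuotientMap.of_surjective_continuous (Stone.stoneRes_surjective h)
      (stoneRes h).continuous
  -- Points with the same restriction to `C` agree on the spectral elements of `f`, so `f` is
  -- constant on the fibres of the quotient map.
  refine ⟨hq.lift f fun φ ψ e => apply_eq_apply_of_specElem fun U hU => ?_, ?_⟩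
  · have := congrArg (fun χ : Stone C => χ.1 ⟨_, hf U⟩) e
    exact this.symm.trans hU
  · exact (hq.lift_comp f _).symm

/-! ### Equality of classes and independence of representatives. -/

namespace F

theorem mk_comp_stoneRes (h : C.carrier ⊆ D.carrier) (f : Func C) :
    F.mk D (f.comp (stoneRes h)) = F.mk C f :=
  (Quot.sound (⟨h, rfl⟩ : FRel P ⟨C, f⟩ ⟨D, f.comp (stoneRes h)⟩)).symm

theorem exists_mk (x : F P) : ∃ (C : BoolSub P) (f : Func C), x = F.mk C f := by
  obtain ⟨⟨C, f⟩, rfl⟩ := Quot.exists_rep x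
  exact ⟨C, f, rfl⟩

/-- The spectral invariant of an element of `F(P)`. -/
def spec (x : F P) (U : Opens ℂ) : P :=
  Quot.lift (fun y : Σ C : BoolSub P, Func C => specElem y.1 y.2 U) (by
    rintro ⟨C, f⟩ ⟨D, g⟩ ⟨h, e⟩
    change specElem C f U = specElem D g U
    rw [show g = _ from e, specElem_comp_stoneRes]) x

theorem spec_mk (f : Func C) (U : Opens ℂ) : (F.mk C f).spec U = specElem C f U := rfl

theorem mk_injective (C : BoolSub P) : Function.Injective (F.mk C) := fun f g h =>
  eq_of_specElem fun U => by rw [← spec_mk, h, spec_mk]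

/-- The spectral elements of the common class lie in both subalgebras, so `f` descends to the
intersection. That `g` comes from the same function follows from injectivity of `F.mk D`. This turns
the generated equivalence relation into a single zigzag and makes all operations well defined. -/
theorem exists_inter_of_mk_eq {f : Func C} {g : Func D} (h : F.mk C f = F.mk D g) :
    ∃ k : Func (C.inter D), f = k.comp (stoneRes BoolSub.inter_subset_left) ∧
      g = k.comp (stoneRes BoolSub.inter_subset_right) := by
  obtain ⟨k, hk⟩ := exists_comp_stoneRes (C := C.inter D) (D := C) BoolSub.inter_subset_left f
    fun U => ⟨specElem_mem f U, by rw [← spec_mk, h]; exact specElem_mem g U⟩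
  refine ⟨k, hk, mk_injective D ?_⟩
  rw [← h, hk, mk_comp_stoneRes]
  exact (mk_comp_stoneRes BoolSub.inter_subset_right k).symm

theorem exists_mk_eq_iff {x : F P} : (∃ f, F.mk C f = x) ↔ ∀ U, x.spec U ∈ C.carrier := by
  constructor
  · rintro ⟨f, rfl⟩ U
    exact specElem_mem f U
  · intro h
    obtain ⟨D, f, rfl⟩ := x.exists_mk
    obtain ⟨k, rfl⟩ := exists_comp_stoneRes (C := C.inter D) BoolSub.inter_subset_right f
      fun U => ⟨h U, specElem_mem f U⟩
    refine ⟨k.comp (stoneRes BoolSub.inter_subset_left), ?_⟩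
    rw [mk_comp_stoneRes, mk_comp_stoneRes]

theorem comm_mk (f g : Func C) : Comm (F.mk C f) (F.mk C g) := ⟨C, f, g, rfl, rfl⟩

theorem mk_add_congr {f f' : Func C} {g g' : Func D} (h : F.mk C f = F.mk D g)
    (h' : F.mk C f' = F.mk D g') : F.mk D (g + g') = F.mk C (f + f') := by
  obtain ⟨k, rfl, rfl⟩ := exists_inter_of_mk_eq h
  obtain ⟨l, rfl, rfl⟩ := exists_inter_of_mk_eq h'
  exact (mk_comp_stoneRes BoolSub.inter_subset_right (k + l)).trans
    (mk_comp_stoneRes BoolSub.inter_subset_left (k + l)).symm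

theorem add_mk (f g : Func C) (h : Comm (F.mk C f) (F.mk C g)) :
    PiecewiseOps.add _ _ h = F.mk C (f + g) :=
  mk_add_congr h.choose_spec.choose_spec.choose_spec.1 h.choose_spec.choose_spec.choose_spec.2

theorem mk_mul_congr {f f' : Func C} {g g' : Func D} (h : F.mk C f = F.mk D g)
    (h' : F.mk C f' = F.mk D g') : F.mk D (g * g') = F.mk C (f * f') := by
  obtain ⟨k, rfl, rfl⟩ := exists_inter_of_mk_eq h
  obtain ⟨l, rfl, rfl⟩ := exists_inter_of_mk_eq h'
  exact (mk_comp_stoneRes BoolSub.inter_subset_right (k * l)).trans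
    (mk_comp_stoneRes BoolSub.inter_subset_left (k * l)).symm

theorem mul_mk (f g : Func C) (h : Comm (F.mk C f) (F.mk C g)) :
    PiecewiseOps.mul _ _ h = F.mk C (f * g) :=
  mk_mul_congr h.choose_spec.choose_spec.choose_spec.1 h.choose_spec.choose_spec.choose_spec.2

theorem star_mk (f : Func C) : star (F.mk C f) = F.mk C (star f) := rfl

theorem smul_mk (z : ℂ) (f : Func C) : z • F.mk C f = F.mk C (z • f) := rfl

theorem trivial_subset (C : BoolSub P) : (BoolSub.trivial P).carrier ⊆ C.carrier := by
  rintro p (rfl | rfl)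
  exacts [C.bot_mem, C.top_mem]

theorem mk_zero (C : BoolSub P) : F.mk C 0 = 0 := mk_comp_stoneRes (trivial_subset C) 0

theorem mk_one (C : BoolSub P) : F.mk C 1 = 1 := mk_comp_stoneRes (trivial_subset C) 1

theorem norm_mk (f : Func C) : ‖F.mk C f‖ = ‖f‖ := by
  -- The norm is defined through `Quot.out`, so the supremum must be compared for an arbitrary
  -- representative. Restriction maps are surjective and therefore preserve suprema.
  have key : ∀ y : Σ C : BoolSub P, Func C, F.mk y.1 y.2 = F.mk C f →
      (⨆ φ, ‖y.2 φ‖) = ‖f‖ := by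
    rintro ⟨D, g⟩ (h : F.mk D g = F.mk C f)
    obtain ⟨k, rfl, rfl⟩ := exists_inter_of_mk_eq h
    rw [ContinuousMap.norm_eq_iSup_norm]
    exact ((Stone.stoneRes_surjective _).iSup_comp fun φ => ‖k φ‖).trans
      ((Stone.stoneRes_surjective _).iSup_comp fun φ => ‖k φ‖).symm
  exact key _ (Quot.out_eq (F.mk C f))

/-! ### Projections of `F(P)` -/

/-- The projection of `F(P)` given by an element of `P`. -/
def proj (p : P) : Proj (F P) :=
  ⟨F.mk (BoolSub.single p) (chi ⟨p, BoolSub.mem_single p⟩),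
    by rw [star_mk, star_chi], by rw [mul_mk, chi_mul_self]⟩

theorem coe_proj_eq_mk (p : C.carrier) : (proj (p : P) : F P) = F.mk C (chi p) := by
  have hp : (p : P) ∈ ((BoolSub.single (p : P)).inter C).carrier := ⟨BoolSub.mem_single _, p.2⟩
  exact (mk_comp_stoneRes BoolSub.inter_subset_left (chi ⟨(p : P), hp⟩)).trans
    (mk_comp_stoneRes BoolSub.inter_subset_right (chi ⟨(p : P), hp⟩)).symm

/-- The nonzero complex numbers. -/
def nonzero : Opens ℂ := ⟨{0}ᶜ, isOpen_compl_singleton⟩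

/-- The smallest element of `P` whose projection supports a given element of `F(P)`. -/
def support (x : F P) : P := x.spec nonzero

theorem support_mk_le_iff {f : Func C} {p : C.carrier} :
    (F.mk C f).support ≤ p ↔ f * chi p = f := by
  constructor
  · intro h
    ext φ
    by_cases hφ : f φ = 0
    · simp [hφ]
    · have := φ.map_mono (q := p) h (specElem_apply (U := nonzero) hφ)
      simp [chi_apply, this]
  · intro h
    refine sSup_le ?_
    rintro q ⟨hq, hqU⟩
    refine Stone.le_of_basic_subset (p := ⟨q, hq⟩) (q := p) fun φ hφ => ?_
    by_contra hp
    have := DFunLike.congr_fun h φ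
    rw [ContinuousMap.mul_apply, chi_apply, if_neg (show ¬ φ.1 p = true from hp), mul_zero] at this
    exact hqU φ hφ this.symm

theorem support_proj (p : P) : (proj p : F P).support = p := by
  refine le_antisymm ?_ ?_
  · exact support_mk_le_iff.2 (chi_mul_self _)
  · exact le_sSup ⟨BoolSub.mem_single p, fun φ hφ => by
      rw [chi_apply, if_pos hφ]
      exact one_ne_zero⟩

theorem exists_chi_eq {f : Func C} (h : f * f = f) : ∃ p, f = chi p := by
  -- An idempotent function only takes the values 0 and 1. The two balls of radius 1/2 around these
  -- values are disjoint, so the spectral element of the ball around 1 is true exactly where the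
  -- value is 1.
  refine ⟨⟨specElem C f ⟨_, Metric.isOpen_ball (x := (1 : ℂ)) (ε := 1 / 2)⟩, specElem_mem _ _⟩, ?_⟩
  ext φ
  have h₀ : f φ * f φ = f φ := DFunLike.congr_fun h φ
  have hb : Disjoint (Metric.ball (0 : ℂ) (1 / 2)) (Metric.ball (1 : ℂ) (1 / 2)) :=
    Metric.ball_disjoint_ball (by simp; norm_num)
  rw [chi_apply]
  rcases mul_left_eq_self₀.1 h₀ with h₁ | h₀
  · rw [h₁, if_pos (specElem_apply (by rw [h₁]; simp))]
  · rw [h₀, if_neg]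
    have h₁ := specElem_apply (f := f) (φ := φ)
      (U := ⟨_, Metric.isOpen_ball (x := (0 : ℂ)) (ε := 1 / 2)⟩) (by rw [h₀]; simp)
    have h₂ := φ.map_mono (q := (⟨_, specElem_mem f ⟨_, Metric.isOpen_ball⟩⟩ : C.carrier)ᶜ)
      (specElem_le_compl f (U := ⟨_, Metric.isOpen_ball⟩) (V := ⟨_, Metric.isOpen_ball⟩) hb) h₁
    rw [Stone.map_compl] at h₂
    simpa using h₂

theorem proj_support (x : Proj (F P)) : proj (x : F P).support = x := by
  obtain ⟨x, hx, hx'⟩ := x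
  obtain ⟨C, f, rfl⟩ := x.exists_mk
  rw [mul_mk] at hx'
  obtain ⟨p, rfl⟩ := exists_chi_eq (mk_injective C hx')
  apply Subtype.ext
  change (proj (F.mk C (chi p)).support : F P) = F.mk C (chi p)
  rw [← coe_proj_eq_mk, support_proj]

/-- The elements of `P` are the projections of `F(P)`. -/
def projEquiv (P : Type u) [CompleteOrthomodularLattice P] : P ≃ Proj (F P) where
  toFun := proj
  invFun x := (x : F P).support
  left_inv := support_proj
  right_inv := proj_support

theorem map_proj {f : P → Q} (hf : IsCOMLHom f) (p : P) :
    F.map hf (proj p) = proj (f p) := by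
  exact (coe_proj_eq_mk (C := (BoolSub.single p).map hf)
    ⟨f p, p, BoolSub.mem_single p, rfl⟩).symm

theorem isPiecewiseHom_map {f : P → Q} (hf : IsCOMLHom f) : IsPiecewiseHom (F.map hf) where
  map_comm := by
    rintro _ _ ⟨C, g, k, rfl, rfl⟩
    exact comm_mk (C := C.map hf) _ _
  map_mul := by
    rintro _ _ ⟨C, g, k, rfl, rfl⟩
    rw [mul_mk]
    exact (mul_mk (g.comp (stoneMap hf C)) (k.comp (stoneMap hf C)) (comm_mk _ _)).symm
  map_add := by
    rintro _ _ ⟨C, g, k, rfl, rfl⟩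
    rw [add_mk]
    exact (add_mk (g.comp (stoneMap hf C)) (k.comp (stoneMap hf C)) (comm_mk _ _)).symm
  map_smul z x := by
    obtain ⟨C, g, rfl⟩ := x.exists_mk
    rfl
  map_star x := by
    obtain ⟨C, g, rfl⟩ := x.exists_mk
    rfl
  map_one := mk_one ((BoolSub.trivial P).map hf)

theorem projMap_map {f : P → Q} (hf : IsCOMLHom f) (p : P) :
    projMap (isPiecewiseHom_map hf) (proj p) = proj (f p) :=
  Subtype.ext (map_proj hf p)

theorem support_projMap_map {f : P → Q} (hf : IsCOMLHom f) (x : Proj (F P)) :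
    (projMap (isPiecewiseHom_map hf) x : F Q).support = f (x : F P).support := by
  rw [← proj_support x, projMap_map, support_proj, support_proj]

end F

end SpectralInvariant

/-! ### Transport of structure along bijections -/

section Transfer

/-- The commutative C*-algebra structure transported along a bijection. -/
abbrev commCStarAlgebraOfEquiv {T R : Type u} [CommCStarAlgebra R] (e : T ≃ R) :
    CommCStarAlgebra T :=
  letI : CommRing T := e.commRing
  letI : Algebra ℂ T := e.algebra ℂ
  letI : NormedCommRing T := NormedCommRing.induced T R (e.algEquiv ℂ).toAlgHom e.injective
  letI : NormedAlgebra ℂ T := NormedAlgebra.induced ℂ T R (e.algEquiv ℂ).toAlgHom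
  letI : StarRing T :=
    { star := fun a => e.symm (star (e a))
      star_involutive := fun a => by
        change e.symm (star (e (e.symm (star (e a))))) = a
        rw [e.apply_symm_apply, star_star, e.symm_apply_apply]
      star_mul := fun a b => by
        change e.symm (star (e (e.symm (e a * e b)))) =
          e.symm (e (e.symm (star (e b))) * e (e.symm (star (e a))))
        simp only [e.apply_symm_apply, star_mul]
      star_add := fun a b => by
        change e.symm (star (e (e.symm (e a + e b)))) =
          e.symm (e (e.symm (star (e a))) + e (e.symm (star (e b))))
        simp only [e.apply_symm_apply, star_add] }
  { toNormedCommRing := inferInstance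
    toStarRing := inferInstance
    toNormedAlgebra := inferInstance
    toCompleteSpace := (IsometryEquiv.mk e (AddMonoidHomClass.isometry_of_norm
      (e.algEquiv ℂ).toAlgHom fun _ => rfl)).completeSpace_iff.2 inferInstance
    toCStarRing := ⟨fun a => by
      change ‖e a‖ * ‖e a‖ ≤ ‖e (e.symm (e (e.symm (star (e a))) * e a))‖
      rw [e.apply_symm_apply, e.apply_symm_apply]
      exact CStarRing.norm_mul_self_le (e a)⟩
    toStarModule := ⟨fun z a => by
      change e.symm (star (e (e.symm (z • e a)))) = e.symm (star z • e (e.symm (star (e a))))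
      rw [e.apply_symm_apply, e.apply_symm_apply, star_smul]⟩ }

theorem isAWStar_of_mulEquiv {T R : Type u} [CStarAlgebra T] [CStarAlgebra R] (e : T ≃ R)
    (h_mul : ∀ a b, e (a * b) = e a * e b) (h_star : ∀ a, e (star a) = star (e a))
    (h_zero : e 0 = 0) (h : IsAWStar R) : IsAWStar T := by
  intro S
  obtain ⟨p, hp, hS⟩ := h (e '' S)
  refine ⟨e.symm p, ⟨e.injective ?_, e.injective ?_⟩, ?_⟩
  · rw [h_mul, e.apply_symm_apply]
    exact hp.isIdempotentElem
  · rw [h_star, e.apply_symm_apply]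
    exact hp.isSelfAdjoint
  · ext y
    have := Set.ext_iff.1 hS (e y)
    simp only [Set.mem_ofPred_eq, Set.forall_mem_image, Set.mem_range, ← h_mul,
      ← h_zero, e.injective.eq_iff] at this
    refine this.trans ⟨?_, ?_⟩
    · rintro ⟨r, hr⟩
      refine ⟨e.symm r, e.injective ?_⟩
      rw [h_mul, e.apply_symm_apply, e.apply_symm_apply, hr]
    · rintro ⟨r, rfl⟩
      refine ⟨e r, ?_⟩
      rw [h_mul, e.apply_symm_apply]

/-- The complete orthomodular lattice structure transported along a bijection. -/
abbrev completeOrthomodularLatticeOfEquiv {T P : Type u} [CompleteOrthomodularLattice P]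
    (e : T ≃ P) : CompleteOrthomodularLattice T where
  le a b := e a ≤ e b
  le_refl _ := le_refl _
  le_trans _ _ _ := le_trans (α := P)
  le_antisymm _ _ h h' := e.injective (le_antisymm h h')
  sup a b := e.symm (e a ⊔ e b)
  inf a b := e.symm (e a ⊓ e b)
  top := e.symm ⊤
  bot := e.symm ⊥
  sSup S := e.symm (sSup (e '' S))
  sInf S := e.symm (sInf (e '' S))
  compl a := e.symm (e a)ᶜ
  le_sup_left a b := by simp
  le_sup_right a b := by simp
  sup_le a b c h h' := by simpa using ⟨h, h'⟩
  inf_le_left a b := by simp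
  inf_le_right a b := by simp
  le_inf a b c h h' := by simpa using ⟨h, h'⟩
  isLUB_sSup S := by
    refine ⟨fun a ha => ?_, fun a ha => ?_⟩
    · change e a ≤ e (e.symm _)
      rw [e.apply_symm_apply]
      exact le_sSup ⟨a, ha, rfl⟩
    · change e (e.symm _) ≤ e a
      rw [e.apply_symm_apply]
      refine sSup_le ?_
      rintro _ ⟨b, hb, rfl⟩
      exact ha hb
  isGLB_sInf S := by
    refine ⟨fun a ha => ?_, fun a ha => ?_⟩
    · change e (e.symm _) ≤ e a
      rw [e.apply_symm_apply]
      exact sInf_le ⟨a, ha, rfl⟩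
    · change e a ≤ e (e.symm _)
      rw [e.apply_symm_apply]
      refine le_sInf ?_
      rintro _ ⟨b, hb, rfl⟩
      exact ha hb
  le_top a := by simp
  bot_le a := by simp
  compl_antitone p q h := by
    simpa using CompleteOrthomodularLattice.compl_antitone _ _ h
  compl_involutive p := by
    rw [e.apply_symm_apply, oml_compl_compl, e.symm_apply_apply]
  sup_compl p := by
    change e.symm (e p ⊔ e (e.symm _)) = e.symm ⊤
    rw [e.apply_symm_apply, CompleteOrthomodularLattice.sup_compl]
  inf_compl p := by
    change e.symm (e p ⊓ e (e.symm _)) = e.symm ⊥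
    rw [e.apply_symm_apply, CompleteOrthomodularLattice.inf_compl]
  orthomodular p q h := by
    change e.symm (e p ⊔ e (e.symm (e (e.symm _) ⊓ e q))) = q
    rw [e.apply_symm_apply, e.apply_symm_apply, CompleteOrthomodularLattice.orthomodular _ _ h,
      e.symm_apply_apply]

end Transfer

/-! ### `F(P)` is a piecewise AW*-algebra -/

section PiecewiseAWStarF

variable {P Q : Type u} [CompleteOrthomodularLattice P] [CompleteOrthomodularLattice Q]
  {C D E : BoolSub P}

namespace F

theorem support_le_compl_of_mul_eq_zero {f g : Func C} (h : f * g = 0) :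
    (F.mk C f).support ≤ (F.mk C g).supportᶜ := by
  refine sSup_le ?_
  rintro p ⟨hp, hpU⟩
  rw [oml_le_compl]
  refine sSup_le ?_
  rintro q ⟨hq, hqV⟩
  refine Stone.le_of_basic_subset (p := ⟨q, hq⟩) (q := (⟨p, hp⟩ : C.carrier)ᶜ) fun φ hφ => ?_
  change φ.1 _ = true
  rw [Stone.map_compl, Bool.not_eq_true', ← Bool.not_eq_true]
  intro hφ'
  have : f φ * g φ = 0 := DFunLike.congr_fun h φ
  rcases mul_eq_zero.1 this with h | h
  · exact hpU φ hφ' h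
  · exact hqV φ hφ h

theorem support_mem (f : Func C) : (F.mk C f).support ∈ C.carrier := specElem_mem f _

/-- Since `C` is closed under arbitrary suprema, the supports of the functions in `S` have a
supremum `p` in `C`. A function annihilates `S` exactly when its support is orthogonal to `p`. -/
theorem isAWStar_func (C : BoolSub P) : IsAWStar (Func C) := by
  intro S
  let p : C.carrier := ⟨sSup ((fun f => (F.mk C f).support) '' S), C.sSup_mem _ (by
    rintro _ ⟨f, -, rfl⟩
    exact support_mem f)⟩
  refine ⟨chi pᶜ, ⟨chi_mul_self _, star_chi _⟩, ?_⟩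
  ext y
  constructor
  · intro hy
    refine ⟨y, ?_⟩
    change chi pᶜ * y = y
    rw [mul_comm, ← support_mk_le_iff]
    change _ ≤ (p : P)ᶜ
    rw [oml_le_compl]
    refine sSup_le ?_
    rintro _ ⟨f, hf, rfl⟩
    exact support_le_compl_of_mul_eq_zero (hy f hf)
  · rintro ⟨r, rfl⟩ f hf
    have h : f * chi p = f := support_mk_le_iff.1 (le_sSup ⟨f, hf, rfl⟩)
    change f * (chi pᶜ * r) = 0
    rw [← h, chi_compl, mul_assoc, ← mul_assoc (chi p), mul_sub, mul_one, chi_mul_self, sub_self,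
      zero_mul, mul_zero]

/-- The functions on a Stone space, regarded as elements of `F(P)`. -/
def funcEquiv (C : BoolSub P) : Set.range (F.mk C) ≃ Func C :=
  (Equiv.ofInjective _ (mk_injective C)).symm

theorem mk_funcEquiv (x : Set.range (F.mk C)) : F.mk C (funcEquiv C x) = x :=
  congrArg Subtype.val ((Equiv.ofInjective _ (mk_injective C)).apply_symm_apply x)

instance : CommCStarAlgebra (Set.range (F.mk C)) := commCStarAlgebraOfEquiv (funcEquiv C)

theorem isCommCStarOn_range (C : BoolSub P) : IsCommCStarOn (Set.range (F.mk C)) where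
  pairwiseComm := by
    rintro _ ⟨f, rfl⟩ _ ⟨g, rfl⟩
    exact comm_mk f g
  coe_zero := mk_zero C
  coe_one := mk_one C
  coe_star x := by
    conv_rhs => rw [← mk_funcEquiv x]
    rfl
  coe_smul z x := by
    conv_rhs => rw [← mk_funcEquiv x]
    rfl
  norm_coe x := by
    conv_lhs => rw [← mk_funcEquiv x, norm_mk]
    rfl
  coe_add := by
    rintro ⟨_, f, rfl⟩ ⟨_, g, rfl⟩ h
    exact (mk_add_congr (mk_funcEquiv ⟨_, f, rfl⟩).symm (mk_funcEquiv ⟨_, g, rfl⟩).symm).trans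
      (add_mk f g h).symm
  coe_mul := by
    rintro ⟨_, f, rfl⟩ ⟨_, g, rfl⟩ h
    exact (mk_mul_congr (mk_funcEquiv ⟨_, f, rfl⟩).symm (mk_funcEquiv ⟨_, g, rfl⟩).symm).trans
      (mul_mk f g h).symm

theorem mul_range_eq_iff {f g k : Func C} :
    (⟨F.mk C f, f, rfl⟩ * ⟨F.mk C g, g, rfl⟩ : Set.range (F.mk C)) = ⟨F.mk C k, k, rfl⟩ ↔
      f * g = k := by
  rw [Subtype.ext_iff, (isCommCStarOn_range C).coe_mul _ _ (comm_mk f g), mul_mk]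
  exact (mk_injective C).eq_iff

theorem exists_chi_of_isStarProjection {x : Set.range (F.mk C)} (h : IsStarProjection x) :
    ∃ p, x = ⟨F.mk C (chi p), chi p, rfl⟩ := by
  obtain ⟨_, f, rfl⟩ := x
  obtain ⟨p, rfl⟩ := exists_chi_eq (mul_range_eq_iff.1 h.isIdempotentElem)
  exact ⟨p, rfl⟩

theorem isCommAWStarOn_range (C : BoolSub P) :
    IsCommAWStarOn (fun x : F P => proj x.support)
      (fun X _ => proj (sSup ((fun x : Proj (F P) => (x : F P).support) '' X)))
      (Set.range (F.mk C)) where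
  toIsCommCStarOn := isCommCStarOn_range C
  isAWStar := isAWStar_of_mulEquiv (funcEquiv C)
    (fun _ _ => (funcEquiv C).apply_symm_apply _) (fun _ => (funcEquiv C).apply_symm_apply _)
    ((funcEquiv C).apply_symm_apply _) (isAWStar_func C)
  coe_rp := by
    rintro ⟨_, f, rfl⟩
    refine ⟨⟨F.mk C (chi ⟨_, support_mem f⟩), _, rfl⟩, (coe_proj_eq_mk _).symm, ?_, ?_⟩
    · exact mul_range_eq_iff.2 (support_mk_le_iff.1 le_rfl)
    · intro q hq h
      obtain ⟨q, rfl⟩ := exists_chi_of_isStarProjection hq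
      have := support_mk_le_iff.2 (mul_range_eq_iff.1 h)
      refine mul_range_eq_iff.2 ?_
      rw [chi_mul_chi, inf_eq_left.2]
      exact this
  coe_sup X hX hXC := by
    have hmem : ∀ x ∈ X, (x : F P).support ∈ C.carrier := by
      intro x hx
      obtain ⟨f, hf⟩ := hXC x hx
      rw [← hf]
      exact support_mem f
    have hs : sSup ((fun x : Proj (F P) => (x : F P).support) '' X) ∈ C.carrier :=
      C.sSup_mem _ (by rintro _ ⟨x, hx, rfl⟩; exact hmem x hx)
    refine ⟨⟨F.mk C (chi ⟨_, hs⟩), _, rfl⟩, (coe_proj_eq_mk _).symm, ?_, ?_⟩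
    · rintro ⟨_, f, rfl⟩ ⟨y, hy, h⟩
      refine mul_range_eq_iff.2 (support_mk_le_iff.1 ?_)
      rw [← show (y : F P) = F.mk C f from h]
      exact le_sSup ⟨y, hy, rfl⟩
    · intro q hq h
      obtain ⟨q, rfl⟩ := exists_chi_of_isStarProjection hq
      refine mul_range_eq_iff.2 ?_
      rw [chi_mul_chi, inf_eq_left.2]
      refine sSup_le (α := P) ?_
      rintro _ ⟨x, hx, rfl⟩
      obtain ⟨f, hf⟩ := hXC x hx
      have := h ⟨F.mk C f, f, rfl⟩ ⟨x, hx, hf.symm⟩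
      change (x : F P).support ≤ (q : P)
      rw [← hf]
      exact support_mk_le_iff.2 (mul_range_eq_iff.1 this)

/-- All spectral elements of the elements of a subset of `F(P)`. -/
def specSet (S : Set (F P)) : Set P := {p | ∃ x ∈ S, ∃ U, p = x.spec U}

theorem specSet_latComm {S : Set (F P)} (hS : PairwiseComm S) :
    ∀ p ∈ specSet S, ∀ q ∈ specSet S, LatComm p q := by
  rintro _ ⟨x, hx, U, rfl⟩ _ ⟨y, hy, V, rfl⟩
  obtain ⟨C, f, g, rfl, rfl⟩ := hS x hx y hy
  exact C.latComm _ (specElem_mem f U) _ (specElem_mem g V)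

/-- The elements of `F(P)` with spectral elements in the subalgebra generated by `S`. -/
def genSet (S : Set (F P)) : Set (F P) :=
  {x | ∀ U, x.spec U ∈ commutant (commutant (specSet S))}

theorem genSet_eq_range {S : Set (F P)} (hS : PairwiseComm S) :
    genSet S = Set.range (F.mk (BoolSub.gen (specSet S) (specSet_latComm hS))) := by
  ext x
  exact (exists_mk_eq_iff (C := BoolSub.gen (specSet S) (specSet_latComm hS))).symm

theorem subset_genSet (S : Set (F P)) : S ⊆ genSet S :=
  fun x hx U => subset_commutant_commutant (specSet S) ⟨x, hx, U, rfl⟩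

theorem genSet_mono {S S' : Set (F P)} (h : S ⊆ S') : genSet S ⊆ genSet S' := by
  intro x hx U
  refine commutant_anti (commutant_anti ?_) (hx U)
  rintro _ ⟨y, hy, V, rfl⟩
  exact ⟨y, h hy, V, rfl⟩

/-- The algebra assigned to `S` consists of the elements whose spectral elements lie in the
bicommutant of those of `S`. Coherence reduces to monotonicity of the bicommutant. -/
instance : PiecewiseAWStar (F P) where
  exists_commCStar S hS := by
    refine ⟨genSet S, subset_genSet S, ?_⟩
    rw [genSet_eq_range hS]
    exact ⟨inferInstance, isCommCStarOn_range _⟩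
  rp x := proj x.support
  sup X _ := proj (sSup ((fun x : Proj (F P) => (x : F P).support) '' X))
  exists_commAWStar := by
    refine ⟨genSet, fun S hS => ⟨subset_genSet S, ?_⟩, fun _ _ _ _ h => genSet_mono h⟩
    rw [genSet_eq_range hS]
    exact ⟨inferInstance, isCommAWStarOn_range _⟩

theorem sup_eq (X : Set (Proj (F P))) (hX : PairwiseCommProj X) :
    PiecewiseAWStar.sup X hX = proj (sSup ((fun x : Proj (F P) => (x : F P).support) '' X)) := rfl

theorem isPiecewiseAWHom_map {f : P → Q} (hf : IsCOMLHom f) : IsPiecewiseAWHom (F.map hf) where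
  toIsPiecewiseHom := isPiecewiseHom_map hf
  map_sup X hX := by
    rw [sup_eq, sup_eq, projMap_map, hf.map_sSup, Set.image_image, Set.image_image]
    simp only [support_projMap_map]

instance : CompleteOrthomodularLattice (Proj (F P)) :=
  completeOrthomodularLatticeOfEquiv (projEquiv P).symm

theorem isCOMLHom_proj : IsCOMLHom (proj : P → Proj (F P)) where
  map_compl p := by
    change proj pᶜ = proj (proj p : F P).supportᶜ
    rw [support_proj]
  map_sSup S := by
    change proj (sSup S) = proj (sSup ((fun x : Proj (F P) => (x : F P).support) '' (proj '' S)))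
    simp only [Set.image_image, support_proj, Set.image_id']

theorem isCOMLHom_support : IsCOMLHom (fun x : Proj (F P) => (x : F P).support) where
  map_compl _ := support_proj _
  map_sSup _ := support_proj _

/-- Two commeasurable elements of `P` generate a single Boolean subalgebra, on which both
projections are represented. -/
theorem latComm_support_iff {x y : Proj (F P)} :
    LatComm (x : F P).support (y : F P).support ↔ Comm (x : F P) (y : F P) := by
  constructor
  · intro h
    have hX : ∀ p ∈ ({(x : F P).support, (y : F P).support} : Set P),
        ∀ q ∈ ({(x : F P).support, (y : F P).support} : Set P), LatComm p q := by
      rintro p (rfl | rfl) q (rfl | rfl)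
      exacts [latComm_refl _, h, latComm_symm h, latComm_refl _]
    rw [← proj_support x, ← proj_support y,
      coe_proj_eq_mk (C := BoolSub.gen _ hX) ⟨_, subset_commutant_commutant _ (Or.inl rfl)⟩,
      coe_proj_eq_mk (C := BoolSub.gen _ hX) ⟨_, subset_commutant_commutant _ (Or.inr rfl)⟩]
    exact comm_mk _ _
  · rintro ⟨C, f, g, hf, hg⟩
    rw [hf, hg]
    exact C.latComm _ (support_mem f) _ (support_mem g)

theorem latComm_iff_comm {x y : Proj (F P)} : LatComm x y ↔ Comm (x : F P) (y : F P) := by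
  rw [← latComm_support_iff]
  refine ⟨fun h => isCOMLHom_support.latComm h, fun h => ?_⟩
  simpa only [proj_support] using isCOMLHom_proj.latComm h

theorem coe_compl_proj (x : Proj (F P)) : ∃ h : Comm (1 : F P) ((-1 : ℂ) • (x : F P)),
    ((xᶜ : Proj (F P)) : F P) = PiecewiseOps.add _ _ h := by
  have hp := BoolSub.mem_single (x : F P).support
  have hx : F.mk _ (chi ⟨_, hp⟩) = (x : F P) := by rw [← coe_proj_eq_mk, proj_support]
  have h1 := mk_one (BoolSub.single (x : F P).support)
  have h : Comm (1 : F P) ((-1 : ℂ) • (x : F P)) := by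
    rw [← hx, ← h1]
    exact comm_mk _ _
  refine ⟨h, ?_⟩
  have e : ((xᶜ : Proj (F P)) : F P) = F.mk _ (chi (⟨_, hp⟩ : (BoolSub.single _).carrier)ᶜ) :=
    coe_proj_eq_mk (⟨_, hp⟩ : (BoolSub.single (x : F P).support).carrier)ᶜ
  rw [e, chi_compl, sub_eq_add_neg, ← neg_one_smul ℂ]
  exact (add_mk 1 ((-1 : ℂ) • chi ⟨_, hp⟩) (comm_mk _ _)).symm.trans 
    (by congr 1; exact congrArg (fun z => (-1 : ℂ) • z) hx)

end F

end PiecewiseAWStarF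

/-! ### Representations of the algebras of functions on Stone spaces -/

section Representations

open WeakDual

variable {P : Type u} [CompleteOrthomodularLattice P] {C : BoolSub P}
  {R : Type u} [CommCStarAlgebra R]

/-- A Boolean homomorphism into the projections of a commutative C*-algebra extends to the
continuous functions on the Stone space. -/
theorem exists_starAlgHom_chi (ι : C.carrier → R) (h_proj : ∀ p, IsStarProjection (ι p))
    (h_compl : ∀ p, ι pᶜ = 1 - ι p) (h_sup : ∀ p q, ι (p ⊔ q) = ι p + ι q - ι p * ι q) :
    ∃ ψ : Func C →⋆ₐ[ℂ] R, ∀ p, ψ (chi p) = ι p := by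
  classical
  have h01 : ∀ (χ : characterSpace ℂ R) p, χ (ι p) = 1 ∨ χ (ι p) = 0 := fun χ p =>
    mul_left_eq_self₀.1 (by rw [← map_mul, (h_proj p).isIdempotentElem.eq])
  have h_cont : ∀ p, Continuous fun χ : characterSpace ℂ R => decide (χ (ι p) = 1) := by
    refine fun p => (continuous_bool_rng true).2 ?_
    have hc : Continuous fun χ : characterSpace ℂ R => χ (ι p) :=
      (gelfandStarTransform R (ι p)).continuous
    refine ⟨?_, ?_⟩
    · convert (isClosed_singleton (x := (1 : ℂ))).preimage hc using 1
      ext χ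
      simp
    · convert (isOpen_compl_singleton (x := (0 : ℂ))).preimage hc using 1
      ext χ
      rcases h01 χ p with h | h <;> simp [h]
  -- A character sends each `ι p` to 0 or 1, so composing it with `ι` gives a point of the Stone
  -- space. Pulling functions back along this continuous map and applying the inverse Gelfand
  -- transform gives the extension.
  let c : C(characterSpace ℂ R, Stone C) :=
    { toFun := fun χ => ⟨fun p => decide (χ (ι p) = 1), fun p q e => by
          obtain rfl : q = pᶜ := Subtype.ext e
          dsimp only
          rw [h_compl, map_sub, map_one]
          rcases h01 χ p with h | h <;> simp [h], fun p q r e => by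
          obtain rfl : r = p ⊔ q := Subtype.ext e
          dsimp only
          rw [h_sup, map_sub, map_add, map_mul]
          rcases h01 χ p with h | h <;> rcases h01 χ q with h' | h' <;> simp [h, h']⟩
      continuous_toFun := continuous_induced_rng.2 (continuous_pi fun p => h_cont p) }
  refine ⟨((gelfandStarTransform R).symm : C(characterSpace ℂ R, ℂ) →⋆ₐ[ℂ] R).comp
    (ContinuousMap.compStarAlgHom' ℂ ℂ c), fun p => ?_⟩
  change (gelfandStarTransform R).symm ((chi p).comp c) = ι p
  rw [StarAlgEquiv.symm_apply_eq]
  ext χ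
  change (if decide (χ (ι p) = 1) = true then (1 : ℂ) else 0) = χ (ι p)
  rcases h01 χ p with h | h <;> simp [h]

/-- Stone-Weierstrass: two distinct points of the Stone space differ at some `p`, so `chi p`
separates them. -/
theorem topologicalClosure_eq_top_of_chi_mem {S : StarSubalgebra ℂ (Func C)} (h : ∀ p, chi p ∈ S) :
    S.topologicalClosure = ⊤ := by
  refine ContinuousMap.starSubalgebra_topologicalClosure_eq_top_of_separatesPoints S ?_
  intro φ ψ hne
  by_contra hcon
  refine hne (Stone.ext fun p => ?_)
  by_contra hp
  refine hcon ⟨chi p, ⟨chi p, h p, rfl⟩, ?_⟩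
  rw [chi_apply, chi_apply]
  cases h₁ : φ.1 p <;> cases h₂ : ψ.1 p <;> simp_all

theorem starAlgHom_ext_chi {ψ₁ ψ₂ : Func C →⋆ₐ[ℂ] R} (h : ∀ p, ψ₁ (chi p) = ψ₂ (chi p)) :
    ψ₁ = ψ₂ := by
  have hc : ∀ ψ : Func C →⋆ₐ[ℂ] R, Continuous ψ := fun ψ =>
    AddMonoidHomClass.continuous_of_bound ψ 1 fun f => by
      simpa only [one_mul] using NonUnitalStarAlgHom.norm_apply_le ψ f
  have hcl : IsClosed (StarAlgHom.equalizer ψ₁ ψ₂ : Set (Func C)) :=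
    isClosed_eq (hc ψ₁) (hc ψ₂)
  have := StarSubalgebra.topologicalClosure_minimal le_rfl hcl
  rw [topologicalClosure_eq_top_of_chi_mem (S := StarAlgHom.equalizer ψ₁ ψ₂) h] at this
  ext1 f
  exact this (show f ∈ (⊤ : StarSubalgebra ℂ (Func C)) from trivial)

/-- A function in the kernel that is nonzero at a point is nonvanishing on some basic clopen set
`p`. There it can be divided out: `f * chi p + chi pᶜ` is a unit whose product with `chi p` is `f *
chi p`, so `chi p` is in the kernel too. -/
theorem starAlgHom_injective_of_chi {ψ : Func C →⋆ₐ[ℂ] R} (h : ∀ p, ψ (chi p) = 0 → p = ⊥) :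
    Function.Injective ψ := by
  rw [injective_iff_map_eq_zero]
  intro f hf
  ext φ
  by_contra hne
  obtain ⟨p, hp, hsub⟩ := Stone.exists_basic_subset
    (isOpen_compl_singleton.preimage f.continuous) (show φ ∈ f ⁻¹' {0}ᶜ from hne)
  have hu : IsUnit (f * chi p + chi pᶜ) := by
    rw [ContinuousMap.isUnit_iff_forall_ne_zero]
    intro χ
    rw [ContinuousMap.add_apply, ContinuousMap.mul_apply, chi_apply, chi_apply, Stone.map_compl]
    by_cases h : χ.1 p = true
    · have : f χ ≠ 0 := hsub h
      simpa [h] using this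
    · simp [h]
  have he : chi p * (f * chi p + chi pᶜ) = f * chi p := by
    rw [chi_compl, mul_add, mul_sub, mul_one, chi_mul_self, sub_self, add_zero, mul_left_comm,
      chi_mul_self]
  have h0 : ψ (chi p) * ψ (f * chi p + chi pᶜ) = 0 := by
    rw [← map_mul, he, map_mul, hf, zero_mul]
  have hbot := h p ((hu.map ψ).mul_left_eq_zero.1 h0)
  subst hbot
  have h₂ : φ.1 ⊥ = true := hp
  rw [Stone.map_bot] at h₂
  simp at h₂

/-- Projections of a commutative AW*-algebra separate its characters. -/
theorem exists_isStarProjection_separating (hR : IsAWStar R) {χ χ' : characterSpace ℂ R}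
    (hne : χ ≠ χ') : ∃ p : R, IsStarProjection p ∧ χ p ≠ χ' p := by
  obtain ⟨h, h0, h1, -⟩ := exists_continuous_zero_one_of_isClosed
    (isClosed_singleton (x := χ)) (isClosed_singleton (x := χ')) (by simpa using hne)
  have h0 : h χ = 0 := h0 rfl
  have h1 : h χ' = 1 := h1 rfl
  -- The functions `f` and `g` are the parts of an Urysohn function below and above level 1/2. Their
  -- product is zero, while `f χ` and `g χ'` are nonzero.
  let f : C(characterSpace ℂ R, ℂ) := ⟨fun x => ((max (1 / 2 - h x) 0 : ℝ) : ℂ), by fun_prop⟩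
  let g : C(characterSpace ℂ R, ℂ) := ⟨fun x => ((max (h x - 1 / 2) 0 : ℝ) : ℂ), by fun_prop⟩
  have hfg : f * g = 0 := by
    ext x
    change ((max (1 / 2 - h x) 0 : ℝ) : ℂ) * ((max (h x - 1 / 2) 0 : ℝ) : ℂ) = 0
    rcases le_total (h x) (1 / 2) with hx | hx
    · rw [max_eq_right (a := h x - 1 / 2) (by linarith)]
      simp
    · rw [max_eq_right (a := 1 / 2 - h x) (by linarith)]
      simp
  have hf : f χ ≠ 0 := by
    change ((max (1 / 2 - h χ) 0 : ℝ) : ℂ) ≠ 0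
    rw [h0]
    norm_num
  have hg : g χ' ≠ 0 := by
    change ((max (h χ' - 1 / 2) 0 : ℝ) : ℂ) ≠ 0
    rw [h1]
    norm_num
  have hχ : ∀ (x : characterSpace ℂ R) (k : C(characterSpace ℂ R, ℂ)),
      x ((gelfandStarTransform R).symm k) = k x := fun x k =>
    DFunLike.congr_fun ((gelfandStarTransform R).apply_symm_apply k) x
  -- Let `p` generate the annihilator of `f`. From `f * p = 0` follows `χ p = 0`. As `g` also
  -- annihilates `f`, it is a multiple of `p`, which forces `χ' p ≠ 0`.
  obtain ⟨p, hp, hann⟩ := hR {(gelfandStarTransform R).symm f}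
  have hfp : (gelfandStarTransform R).symm f * p = 0 :=
    (Set.ext_iff.1 hann p).2 ⟨1, mul_one p⟩ _ rfl
  obtain ⟨r, hr⟩ : (gelfandStarTransform R).symm g ∈ Set.range (fun r : R => p * r) := by
    rw [← hann]
    rintro _ rfl
    rw [← map_mul, hfg, map_zero]
  refine ⟨p, hp, ?_⟩
  have e : χ p = 0 := by
    have := congrArg χ hfp
    rw [map_mul, map_zero, hχ] at this
    exact (mul_eq_zero.1 this).resolve_left hf
  rw [e]
  intro e'
  have := congrArg χ' hr
  rw [map_mul, ← e', zero_mul, hχ] at this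
  exact hg this.symm

/-- The homomorphism is injective, hence isometric, so its range is closed. The range contains all
projections, which separate the characters of an AW*-algebra, and Stone-Weierstrass makes it
everything. -/
theorem starAlgHom_surjective_of_isAWStar (hR : IsAWStar R) {ψ : Func C →⋆ₐ[ℂ] R}
    (h : ∀ p, ψ (chi p) = 0 → p = ⊥) (hp : ∀ p : R, IsStarProjection p → ∃ q, ψ (chi q) = p) :
    Function.Surjective ψ := by
  let γ : Func C →⋆ₐ[ℂ] C(characterSpace ℂ R, ℂ) :=
    (gelfandStarTransform R : R →⋆ₐ[ℂ] C(characterSpace ℂ R, ℂ)).comp ψ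
  have hγ : Function.Injective γ :=
    (gelfandStarTransform R).injective.comp (starAlgHom_injective_of_chi h)
  have hcl : IsClosed (γ.range : Set C(characterSpace ℂ R, ℂ)) := by
    exact (NonUnitalStarAlgHom.isometry γ hγ).isClosedEmbedding.isClosed_range
  have htop : γ.range.topologicalClosure = ⊤ := by
    refine ContinuousMap.starSubalgebra_topologicalClosure_eq_top_of_separatesPoints _ ?_
    intro χ χ' hne
    obtain ⟨p, hp', hsep⟩ := exists_isStarProjection_separating hR hne
    obtain ⟨q, rfl⟩ := hp p hp'
    exact ⟨γ (chi q), ⟨γ (chi q), ⟨chi q, rfl⟩, rfl⟩, hsep⟩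
  intro r
  have hle := StarSubalgebra.topologicalClosure_minimal le_rfl hcl
  rw [htop] at hle
  obtain ⟨f, hf⟩ := hle (show gelfandStarTransform R r ∈ ⊤ from trivial)
  exact ⟨f, (gelfandStarTransform R).injective hf⟩

end Representations

/-! ### Commutative AW*-algebras inside a piecewise AW*-algebra -/

section Parts

/-- A star algebra homomorphism from a map preserving the operations. -/
def starAlgHomOfMap {R S : Type u} [CommCStarAlgebra R] [CommCStarAlgebra S] (f : R → S)
    (h_one : f 1 = 1) (h_mul : ∀ a b, f (a * b) = f a * f b)
    (h_add : ∀ a b, f (a + b) = f a + f b) (h_smul : ∀ (z : ℂ) a, f (z • a) = z • f a)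
    (h_star : ∀ a, f (star a) = star (f a)) : R →⋆ₐ[ℂ] S where
  toFun := f
  map_one' := h_one
  map_mul' := h_mul
  map_zero' := by simpa using h_smul 0 0
  map_add' := h_add
  commutes' z := by rw [Algebra.algebraMap_eq_smul_one, h_smul, h_one,
    Algebra.algebraMap_eq_smul_one]
  map_star' := h_star

/-- A pairwise commeasurable subset that is a commutative AW*-algebra. -/
structure AWPart (A : Type u) [PiecewiseAWStar A] where
  carrier : Set A
  [commCStarAlgebra : CommCStarAlgebra carrier]
  isCommAWStarOn : IsCommAWStarOn PiecewiseAWStar.rp PiecewiseAWStar.sup carrier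

attribute [instance] AWPart.commCStarAlgebra

namespace AWPart

variable {A : Type u} [PiecewiseAWStar A] {M N : AWPart A}

theorem comm (a b : M.carrier) : Comm (a : A) (b : A) :=
  M.isCommAWStarOn.pairwiseComm _ a.2 _ b.2

theorem coe_mul (a b : M.carrier) :
    ((a * b : M.carrier) : A) = PiecewiseOps.mul _ _ (M.comm a b) :=
  M.isCommAWStarOn.coe_mul a b _

theorem coe_add (a b : M.carrier) :
    ((a + b : M.carrier) : A) = PiecewiseOps.add _ _ (M.comm a b) :=
  M.isCommAWStarOn.coe_add a b _

/-- The inclusion of one commutative AW*-algebra into another. -/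
def incl (h : M.carrier ⊆ N.carrier) : M.carrier →⋆ₐ[ℂ] N.carrier :=
  starAlgHomOfMap (Set.inclusion h)
    (Subtype.ext (M.isCommAWStarOn.coe_one.trans N.isCommAWStarOn.coe_one.symm))
    (fun a b => Subtype.ext ((coe_mul a b).trans
      (coe_mul (Set.inclusion h a) (Set.inclusion h b)).symm))
    (fun a b => Subtype.ext ((coe_add a b).trans
      (coe_add (Set.inclusion h a) (Set.inclusion h b)).symm))
    (fun z a => Subtype.ext ((M.isCommAWStarOn.coe_smul z a).trans
      (N.isCommAWStarOn.coe_smul z (Set.inclusion h a)).symm))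
    (fun a => Subtype.ext ((M.isCommAWStarOn.coe_star a).trans
      (N.isCommAWStarOn.coe_star (Set.inclusion h a)).symm))

theorem incl_injective (h : M.carrier ⊆ N.carrier) : Function.Injective (incl h) :=
  Set.inclusion_injective h

/-- The commutative AW*-algebra assigned to a pairwise commeasurable set. -/
def gen (S : Set A) (hS : PairwiseComm S) : AWPart A :=
  letI := (PiecewiseAWStar.exists_commAWStar.choose_spec.1 S hS).2.choose
  ⟨PiecewiseAWStar.exists_commAWStar.choose S,
    (PiecewiseAWStar.exists_commAWStar.choose_spec.1 S hS).2.choose_spec⟩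

theorem subset_gen {S : Set A} (hS : PairwiseComm S) : S ⊆ (gen S hS).carrier :=
  (PiecewiseAWStar.exists_commAWStar.choose_spec.1 S hS).1

theorem gen_mono {S S' : Set A} (hS : PairwiseComm S) (hS' : PairwiseComm S') (h : S ⊆ S') :
    (gen S hS).carrier ⊆ (gen S' hS').carrier :=
  PiecewiseAWStar.exists_commAWStar.choose_spec.2 S S' hS hS' h

variable {P : Type u} [CompleteOrthomodularLattice P] {C : BoolSub P}

theorem coe_eq_of_chi (h : M.carrier ⊆ N.carrier) {ψ : Func C →⋆ₐ[ℂ] M.carrier}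
    {ψ' : Func C →⋆ₐ[ℂ] N.carrier} (hψ : ∀ p, (ψ (chi p) : A) = ψ' (chi p)) (f : Func C) :
    (ψ f : A) = ψ' f := by
  have : (incl h).comp ψ = ψ' := starAlgHom_ext_chi fun p => Subtype.ext (hψ p)
  rw [← this]
  rfl

/-- The values on projections form a Boolean homomorphism into `M`, which extends to `Func C` inside
`M`. By `coe_eq_of_chi` this extension agrees with `ψ'`, so all values of `ψ'` already lie in `M`.
-/
theorem exists_restrict (h : M.carrier ⊆ N.carrier) (ψ' : Func C →⋆ₐ[ℂ] N.carrier)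
    (hM : ∀ p, (ψ' (chi p) : A) ∈ M.carrier) :
    ∃ ψ : Func C →⋆ₐ[ℂ] M.carrier, ∀ p, (ψ (chi p) : A) = ψ' (chi p) := by
  have hi : ∀ p, incl h ⟨_, hM p⟩ = ψ' (chi p) := fun _ => rfl
  obtain ⟨ψ, hψ⟩ := exists_starAlgHom_chi (fun p => (⟨_, hM p⟩ : M.carrier))
    (fun p => ⟨incl_injective h (by rw [map_mul, hi, ← map_mul, chi_mul_self]),
      incl_injective h (by rw [map_star, hi, ← map_star, star_chi])⟩)
    (fun p => incl_injective h (by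
      rw [map_sub, map_one, hi, hi, chi_compl, map_sub, map_one]))
    (fun p q => incl_injective h (by
      rw [map_sub, map_add, map_mul, hi, hi, hi, chi_sup, map_sub, map_add, map_mul]))
  exact ⟨ψ, fun p => congrArg Subtype.val (hψ p)⟩

/-- The restriction of a piecewise homomorphism on `F(P)` to the functions on a Stone space. -/
def restrict {h : F P → A} (hh : IsPiecewiseHom h) (C : BoolSub P)
    (hM : ∀ f : Func C, h (F.mk C f) ∈ M.carrier) : Func C →⋆ₐ[ℂ] M.carrier :=
  starAlgHomOfMap (fun f => ⟨h (F.mk C f), hM f⟩)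
    (Subtype.ext (by
      rw [M.isCommAWStarOn.coe_one]
      exact (congrArg h (F.mk_one C)).trans hh.map_one))
    (fun f g => Subtype.ext (by
      rw [coe_mul]
      change h (F.mk C (f * g)) = _
      rw [← F.mul_mk f g (F.comm_mk f g)]
      exact hh.map_mul _ _ _))
    (fun f g => Subtype.ext (by
      rw [coe_add]
      change h (F.mk C (f + g)) = _
      rw [← F.add_mk f g (F.comm_mk f g)]
      exact hh.map_add _ _ _))
    (fun z f => Subtype.ext (by
      rw [M.isCommAWStarOn.coe_smul]
      exact hh.map_smul z (F.mk C f)))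
    (fun f => Subtype.ext (by
      rw [M.isCommAWStarOn.coe_star]
      exact hh.map_star (F.mk C f)))

theorem pairwiseComm_image {h : F P → A} (hh : IsPiecewiseHom h) (C : BoolSub P) :
    PairwiseComm (Set.range fun f : Func C => h (F.mk C f)) := by
  rintro _ ⟨f, rfl⟩ _ ⟨g, rfl⟩
  exact hh.map_comm _ _ (F.comm_mk f g)

end AWPart

/-- Piecewise homomorphisms from `F(P)` to a piecewise AW*-algebra that agree on projections are
equal. -/
theorem F.hom_ext {A P : Type u} [PiecewiseAWStar A] [CompleteOrthomodularLattice P]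
    {h₁ h₂ : F P → A} (hh₁ : IsPiecewiseHom h₁) (hh₂ : IsPiecewiseHom h₂)
    (h : ∀ p : P, h₁ (F.proj p) = h₂ (F.proj p)) : h₁ = h₂ := by
  ext x
  obtain ⟨C, f, rfl⟩ := x.exists_mk
  have hc : ∀ p : C.carrier, h₁ (F.mk C (chi p)) = h₂ (F.mk C (chi p)) := fun p => by
    rw [← F.coe_proj_eq_mk, h]
  have hS₁ := AWPart.pairwiseComm_image hh₁ C
  have hS₂ := AWPart.pairwiseComm_image hh₂ C
  have hsub₁ : (Set.range fun p : C.carrier => h₁ (F.mk C (chi p))) ⊆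
      Set.range fun f : Func C => h₁ (F.mk C f) := by
    rintro _ ⟨p, rfl⟩
    exact ⟨chi p, rfl⟩
  have hsub₂ : (Set.range fun p : C.carrier => h₁ (F.mk C (chi p))) ⊆
      Set.range fun f : Func C => h₂ (F.mk C f) := by
    rintro _ ⟨p, rfl⟩
    exact ⟨chi p, (hc p).symm⟩
  -- The images of `Func C` under `h₁` and `h₂` are not known to be commeasurable with each other,
  -- so no common algebra containing both is at hand. They share their values on projections, and by
  -- coherence the algebra assigned to these values is contained in the algebras of both images.
  -- Both maps are compared with one homomorphism `ψ` into it.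
  have hT : PairwiseComm (Set.range fun p : C.carrier => h₁ (F.mk C (chi p))) :=
    fun a ha b hb => hS₁ a (hsub₁ ha) b (hsub₁ hb)
  let ψ₁ := AWPart.restrict (M := AWPart.gen _ hS₁) hh₁ C
    fun f => AWPart.subset_gen hS₁ ⟨f, rfl⟩
  let ψ₂ := AWPart.restrict (M := AWPart.gen _ hS₂) hh₂ C
    fun f => AWPart.subset_gen hS₂ ⟨f, rfl⟩
  obtain ⟨ψ, hψ⟩ := AWPart.exists_restrict (AWPart.gen_mono hT hS₁ hsub₁) ψ₁
    fun p => AWPart.subset_gen hT ⟨p, rfl⟩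
  have e₁ := AWPart.coe_eq_of_chi (AWPart.gen_mono hT hS₁ hsub₁) hψ f
  have e₂ := AWPart.coe_eq_of_chi (AWPart.gen_mono hT hS₂ hsub₂) (ψ' := ψ₂)
    (fun p => (hψ p).trans (hc p)) f
  exact e₁.symm.trans e₂

end Parts

/-! ### Reconstruction of an extended piecewise AW*-algebra from its projections -/

namespace ExtPiecewiseAWStar

variable {X : ExtPiecewiseAWStar.{u}} {C D : BoolSub (Proj X.A)} {M N : AWPart X.A}

/-- The projections in a subalgebra, as elements of the ambient piecewise algebra. -/
def projSet (C : BoolSub (Proj X.A)) : Set X.A := Subtype.val '' C.carrier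

theorem pairwiseComm_projSet (C : BoolSub (Proj X.A)) : PairwiseComm (projSet C) := by
  rintro _ ⟨p, hp, rfl⟩ _ ⟨q, hq, rfl⟩
  exact (X.latComm_iff p q).1 (C.latComm p hp q hq)

theorem isStarProjection_mk {p : Proj X.A} (hp : (p : X.A) ∈ M.carrier) :
    IsStarProjection (⟨p, hp⟩ : M.carrier) :=
  ⟨Subtype.ext ((AWPart.coe_mul _ _).trans p.2.2),
    Subtype.ext ((M.isCommAWStarOn.coe_star _).trans p.2.1)⟩

theorem coe_one_sub {p : Proj X.A} (hp : (p : X.A) ∈ M.carrier) :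
    ((1 - ⟨p, hp⟩ : M.carrier) : X.A) = (pᶜ : Proj X.A) := by
  obtain ⟨h, e⟩ := X.coe_compl p
  rw [e, sub_eq_add_neg, ← neg_one_smul ℂ, AWPart.coe_add]
  congr 1
  · exact M.isCommAWStarOn.coe_one
  · exact M.isCommAWStarOn.coe_smul _ _

theorem compl_mem {p : Proj X.A} (hp : (p : X.A) ∈ M.carrier) :
    ((pᶜ : Proj X.A) : X.A) ∈ M.carrier :=
  coe_one_sub hp ▸ Subtype.coe_prop _

theorem exists_sSup {S : Set (Proj X.A)} (hS : ∀ p ∈ S, (p : X.A) ∈ M.carrier) :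
    ∃ p : M.carrier, (p : X.A) = (sSup S : Proj X.A) ∧
      (∀ x : M.carrier, (∃ y ∈ S, (y : X.A) = x) → x * p = x) ∧
      ∀ q : M.carrier, IsStarProjection q →
        (∀ x : M.carrier, (∃ y ∈ S, (y : X.A) = x) → x * q = x) → p * q = p := by
  have hS' : PairwiseCommProj S := fun p hp q hq =>
    M.isCommAWStarOn.pairwiseComm _ (hS p hp) _ (hS q hq)
  rw [X.sSup_eq S hS']
  exact M.isCommAWStarOn.coe_sup S hS' hS

theorem sSup_mem {S : Set (Proj X.A)} (hS : ∀ p ∈ S, (p : X.A) ∈ M.carrier) :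
    ((sSup S : Proj X.A) : X.A) ∈ M.carrier := by
  obtain ⟨p, hp, -⟩ := exists_sSup hS
  exact hp ▸ p.2

/-- In a commutative algebra `a + b - a * b` is a projection dominating `a` and `b`. Minimality of
the join `s` gives `s * (a + b - a * b) = s`, and `a * s = a`, `b * s = b` turn the left side into
`a + b - a * b`. -/
theorem coe_sup {p q : Proj X.A} (hp : (p : X.A) ∈ M.carrier) (hq : (q : X.A) ∈ M.carrier)
    (h : ((p ⊔ q : Proj X.A) : X.A) ∈ M.carrier) :
    (⟨_, h⟩ : M.carrier) = ⟨p, hp⟩ + ⟨q, hq⟩ - ⟨p, hp⟩ * ⟨q, hq⟩ := by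
  obtain ⟨s, hs, hle, hmin⟩ := exists_sSup (M := M) (S := {p, q}) (by
    rintro x (rfl | rfl) <;> assumption)
  obtain rfl : s = ⟨_, h⟩ := Subtype.ext (by rw [hs, sSup_pair])
  have hp' := isStarProjection_mk hp
  have hq' := isStarProjection_mk hq
  have h₁ := hle ⟨p, hp⟩ ⟨p, Or.inl rfl, rfl⟩
  have h₂ := hle ⟨q, hq⟩ ⟨q, Or.inr rfl, rfl⟩
  have hpp := hp'.isIdempotentElem.eq
  have hqq := hq'.isIdempotentElem.eq
  have hps := hp'.isSelfAdjoint.star_eq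
  have hqs := hq'.isSelfAdjoint.star_eq
  generalize (⟨_, h⟩ : M.carrier) = s at *
  have hx : ∀ x : M.carrier, (∃ y ∈ ({p, q} : Set (Proj X.A)), (y : X.A) = x) →
      x = ⟨p, hp⟩ ∨ x = ⟨q, hq⟩ := by
    rintro x ⟨y, rfl | rfl, hy⟩
    · exact Or.inl (Subtype.ext hy.symm)
    · exact Or.inr (Subtype.ext hy.symm)
  generalize (⟨p, hp⟩ : M.carrier) = a at *
  generalize (⟨q, hq⟩ : M.carrier) = b at *
  have key := hmin (a + b - a * b) ⟨by
      unfold IsIdempotentElem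
      linear_combination (1 - 2 * b + b * b) * hpp + (1 - a) * hqq, by
      change star _ = _
      rw [star_sub, star_add, star_mul, hps, hqs, mul_comm b a]⟩ (by
    intro x hx'
    rcases hx x hx' with rfl | rfl
    · linear_combination (1 - b) * hpp
    · linear_combination (1 - a) * hqq)
  linear_combination - key + (1 - b) * h₁ + h₂

/-- The projections contained in a commutative AW*-algebra. -/
def ofPart (M : AWPart X.A) : BoolSub (Proj X.A) where
  carrier := {p | (p : X.A) ∈ M.carrier}
  latComm p hp q hq := (X.latComm_iff p q).2 (M.isCommAWStarOn.pairwiseComm _ hp _ hq)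
  compl_mem _ hp := compl_mem hp
  sSup_mem _ hS := sSup_mem hS

theorem projSet_ofPart_subset (M : AWPart X.A) : projSet (ofPart M) ⊆ M.carrier := by
  rintro _ ⟨p, hp, rfl⟩
  exact hp

theorem exists_rep (h : projSet C ⊆ M.carrier) :
    ∃ ψ : Func C →⋆ₐ[ℂ] M.carrier, ∀ p : C.carrier, (ψ (chi p) : X.A) = (p : Proj X.A) := by
  have hm : ∀ p : C.carrier, ((p : Proj X.A) : X.A) ∈ M.carrier := fun p => h ⟨p, p.2, rfl⟩
  obtain ⟨ψ, hψ⟩ := exists_starAlgHom_chi (fun p : C.carrier => (⟨_, hm p⟩ : M.carrier))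
    (fun p => isStarProjection_mk (hm p)) (fun p => Subtype.ext (coe_one_sub (hm p)).symm)
    (fun p q => coe_sup (hm p) (hm q) (hm (p ⊔ q)))
  exact ⟨ψ, fun p => congrArg Subtype.val (hψ p)⟩

theorem eq_bot_of_rep_eq_zero {ψ : Func C →⋆ₐ[ℂ] M.carrier}
    (hψ : ∀ p : C.carrier, (ψ (chi p) : X.A) = (p : Proj X.A)) (p : C.carrier)
    (h : ψ (chi p) = 0) : p = ⊥ := by
  have hbot : chi (⊥ : C.carrier) = 0 := by
    ext φ
    simp [chi_apply, Stone.map_bot]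
  refine Subtype.ext (Subtype.ext ?_)
  rw [← hψ, ← hψ, hbot, h, map_zero]

/-- The representation of the functions on a Stone space on the piecewise algebra. -/
def rep (C : BoolSub (Proj X.A)) :
    Func C →⋆ₐ[ℂ] (AWPart.gen _ (pairwiseComm_projSet C)).carrier :=
  (exists_rep (AWPart.subset_gen (pairwiseComm_projSet C))).choose

theorem rep_chi (p : C.carrier) : (rep C (chi p) : X.A) = (p : Proj X.A) :=
  (exists_rep (AWPart.subset_gen (pairwiseComm_projSet C))).choose_spec p

theorem rep_injective (C : BoolSub (Proj X.A)) : Function.Injective (rep C) :=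
  starAlgHom_injective_of_chi (eq_bot_of_rep_eq_zero rep_chi)

/-- By coherence the algebra of `C` sits inside that of `D`, and both maps send `chi p` to `p`.
Compatibility with inclusions is what lets the representations glue to a map on `F (Proj X.A)`. -/
theorem rep_comp_stoneRes (h : C.carrier ⊆ D.carrier) (f : Func C) :
    (rep D (f.comp (stoneRes h)) : X.A) = rep C f :=
  (AWPart.coe_eq_of_chi (AWPart.gen_mono _ _ (Set.image_mono h))
    (ψ' := (rep D).comp (ContinuousMap.compStarAlgHom' ℂ ℂ (stoneRes h)))
    (fun p => (rep_chi p).trans (rep_chi (⟨p, h p.2⟩ : D.carrier)).symm) f).symm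

/-- The canonical map from the algebra constructed from the projections. -/
def toAlgebra (X : ExtPiecewiseAWStar.{u}) : F (Proj X.A) → X.A :=
  Quot.lift (fun x => (rep x.1 x.2 : X.A)) (by
    rintro ⟨C, f⟩ ⟨D, g⟩ ⟨h, e⟩
    change (rep C f : X.A) = rep D g
    rw [show g = f.comp (stoneRes h) from e, rep_comp_stoneRes])

theorem toAlgebra_mk (f : Func C) : X.toAlgebra (F.mk C f) = rep C f := rfl

theorem toAlgebra_proj (p : Proj X.A) : X.toAlgebra (F.proj p) = p :=
  rep_chi (⟨p, BoolSub.mem_single p⟩ : (BoolSub.single p).carrier)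

theorem isPiecewiseHom_toAlgebra (X : ExtPiecewiseAWStar.{u}) : IsPiecewiseHom X.toAlgebra where
  map_comm := by
    rintro _ _ ⟨C, f, g, rfl, rfl⟩
    exact AWPart.comm (rep C f) (rep C g)
  map_mul := by
    rintro _ _ ⟨C, f, g, rfl, rfl⟩
    rw [F.mul_mk, toAlgebra_mk, map_mul]
    exact AWPart.coe_mul _ _
  map_add := by
    rintro _ _ ⟨C, f, g, rfl, rfl⟩
    rw [F.add_mk, toAlgebra_mk, map_add]
    exact AWPart.coe_add _ _
  map_smul z x := by
    obtain ⟨C, f, rfl⟩ := x.exists_mk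
    rw [F.smul_mk, toAlgebra_mk, map_smul]
    exact (AWPart.isCommAWStarOn _).coe_smul _ _
  map_star x := by
    obtain ⟨C, f, rfl⟩ := x.exists_mk
    rw [F.star_mk, toAlgebra_mk, map_star]
    exact (AWPart.isCommAWStarOn _).coe_star _
  map_one := by
    rw [← F.mk_one (BoolSub.trivial _), toAlgebra_mk, map_one]
    exact (AWPart.isCommAWStarOn _).coe_one

theorem projMap_toAlgebra (x : Proj (F (Proj X.A))) :
    projMap X.isPiecewiseHom_toAlgebra x = (x : F (Proj X.A)).support :=
  Subtype.ext (by
    conv_lhs => rw [← F.proj_support x]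
    exact toAlgebra_proj _)

theorem isPiecewiseAWHom_toAlgebra (X : ExtPiecewiseAWStar.{u}) :
    IsPiecewiseAWHom X.toAlgebra where
  toIsPiecewiseHom := X.isPiecewiseHom_toAlgebra
  map_sup S hS := by
    rw [← X.sSup_eq, projMap_toAlgebra, F.sup_eq, F.support_proj]
    congr 1
    exact Set.image_congr fun x _ => (projMap_toAlgebra x).symm

/-- Any representation with the right values on projections computes `toAlgebra`. The projections of
`C` lie in `T(S)` but need not lie in `S`, so the comparison takes place in `T(T(S))`. It contains
`T(S)` by extensivity and `T(projSet C)` by coherence. -/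
theorem toAlgebra_mk_eq_of_chi {S : Set X.A} (hS : PairwiseComm S)
    {ψ : Func C →⋆ₐ[ℂ] (AWPart.gen S hS).carrier}
    (hψ : ∀ p : C.carrier, (ψ (chi p) : X.A) = (p : Proj X.A)) (f : Func C) :
    X.toAlgebra (F.mk C f) = ψ f := by
  have hM : PairwiseComm (AWPart.gen S hS).carrier :=
    (AWPart.gen S hS).isCommAWStarOn.pairwiseComm
  have hsub : projSet C ⊆ (AWPart.gen S hS).carrier := by
    rintro _ ⟨p, hp, rfl⟩
    exact hψ ⟨p, hp⟩ ▸ Subtype.coe_prop _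
  have h := AWPart.subset_gen hM
  refine (AWPart.coe_eq_of_chi (AWPart.gen_mono _ hM hsub) (ψ := rep C)
    (ψ' := (AWPart.incl h).comp ψ) (fun p => ?_) f).trans rfl
  exact (rep_chi p).trans (hψ p).symm

/-- The AW*-algebra `T(S)` is all of the function algebra on the Stone space of its own projections,
by `starAlgHom_surjective_of_isAWStar`. -/
theorem exists_toAlgebra_eq {S : Set X.A} (hS : PairwiseComm S) {a : X.A}
    (ha : a ∈ (AWPart.gen S hS).carrier) :
    ∃ f : Func (ofPart (AWPart.gen S hS)), X.toAlgebra (F.mk _ f) = a := by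
  obtain ⟨ψ, hψ⟩ := exists_rep (projSet_ofPart_subset (AWPart.gen S hS))
  obtain ⟨f, hf⟩ := starAlgHom_surjective_of_isAWStar (AWPart.gen S hS).isCommAWStarOn.isAWStar
    (eq_bot_of_rep_eq_zero hψ) (fun p hp => by
      have hp₁ : star (p : X.A) = p := by
        rw [← (AWPart.isCommAWStarOn _).coe_star, hp.isSelfAdjoint.star_eq]
      have hp₂ : PiecewiseOps.mul (p : X.A) p (comm_refl _) = p := by
        rw [← (AWPart.isCommAWStarOn _).coe_mul, hp.isIdempotentElem.eq]
      exact ⟨⟨⟨p, hp₁, hp₂⟩, p.2⟩, Subtype.ext (hψ _)⟩) ⟨a, ha⟩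
  exact ⟨f, (toAlgebra_mk_eq_of_chi hS hψ f).trans (congrArg Subtype.val hf)⟩

theorem pairwiseComm_singleton {A : Type u} [PiecewiseOps A] (a : A) : PairwiseComm {a} := by
  rintro _ rfl _ rfl
  exact comm_refl _

theorem toAlgebra_injective (X : ExtPiecewiseAWStar.{u}) : Function.Injective X.toAlgebra := by
  -- Two preimages of `a` need not obviously be represented on a common subalgebra, so each is
  -- compared with a representative `k` on the projections of `T({a})`. For `x` represented on `C`,
  -- the element `a` lies in `T(projSet C)`. Hence `T(T(projSet C))` contains both `C` and `T({a})`,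
  -- and `rep` is injective on the functions belonging to its projections.
  have key : ∀ (a : X.A) (k : Func (ofPart (AWPart.gen _ (pairwiseComm_singleton a)))),
      X.toAlgebra (F.mk _ k) = a → ∀ x, X.toAlgebra x = a → x = F.mk _ k := by
    intro a k hk x hx
    obtain ⟨C, f, rfl⟩ := x.exists_mk
    have hM := pairwiseComm_projSet C
    have hN : PairwiseComm (AWPart.gen _ hM).carrier :=
      (AWPart.gen _ hM).isCommAWStarOn.pairwiseComm
    have h₁ : C.carrier ⊆ (ofPart (AWPart.gen _ hN)).carrier := fun p hp =>
      AWPart.subset_gen hN (AWPart.subset_gen hM ⟨p, hp, rfl⟩)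
    have h₂ : (ofPart (AWPart.gen _ (pairwiseComm_singleton a))).carrier ⊆
        (ofPart (AWPart.gen _ hN)).carrier := fun p hp => by
      refine AWPart.gen_mono (pairwiseComm_singleton a) hN ?_ hp
      rintro _ rfl
      rw [← hx]
      exact (rep C f).2
    rw [← F.mk_comp_stoneRes h₁, ← F.mk_comp_stoneRes h₂]
    refine congrArg _ (rep_injective _ (Subtype.ext ?_))
    rw [rep_comp_stoneRes, rep_comp_stoneRes]
    exact hx.trans hk.symm
  intro x y hxy
  obtain ⟨k, hk⟩ := exists_toAlgebra_eq (pairwiseComm_singleton (X.toAlgebra x))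
    (AWPart.subset_gen _ rfl)
  rw [key _ k hk x rfl, key _ k hk y hxy.symm]

theorem toAlgebra_surjective (X : ExtPiecewiseAWStar.{u}) : Function.Surjective X.toAlgebra :=
  fun a => (exists_toAlgebra_eq (pairwiseComm_singleton a) (AWPart.subset_gen _ rfl)).imp' _
    fun _ h => h

/-- A commeasurable pair lies in one assigned algebra, so both elements come from functions on the
same Stone space. Injectivity identifies these with the given `x` and `y`. -/
theorem toAlgebra_comm_iff {x y : F (Proj X.A)} :
    Comm (X.toAlgebra x) (X.toAlgebra y) ↔ Comm x y := by
  refine ⟨fun h => ?_, X.isPiecewiseHom_toAlgebra.map_comm x y⟩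
  have hS : PairwiseComm {X.toAlgebra x, X.toAlgebra y} := by
    rintro a (rfl | rfl) b (rfl | rfl)
    exacts [comm_refl _, h, comm_symm _ _ h, comm_refl _]
  obtain ⟨f, hf⟩ := exists_toAlgebra_eq hS (AWPart.subset_gen hS (Or.inl rfl))
  obtain ⟨g, hg⟩ := exists_toAlgebra_eq hS (AWPart.subset_gen hS (Or.inr rfl))
  have hfg := F.comm_mk f g
  rwa [X.toAlgebra_injective hf, X.toAlgebra_injective hg] at hfg

/-- The canonical bijection from the algebra constructed from the projections. -/
def algebraEquiv (X : ExtPiecewiseAWStar.{u}) : F (Proj X.A) ≃ X.A :=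
  Equiv.ofBijective X.toAlgebra ⟨X.toAlgebra_injective, X.toAlgebra_surjective⟩

end ExtPiecewiseAWStar

/-! ### The equivalence of categories -/

theorem mul_congr {A : Type u} [PiecewiseOps A] {a a' b b' : A} (ha : a = a') (hb : b = b')
    (h : Comm a b) (h' : Comm a' b') : PiecewiseOps.mul a b h = PiecewiseOps.mul a' b' h' := by
  subst ha hb
  rfl

theorem add_congr {A : Type u} [PiecewiseOps A] {a a' b b' : A} (ha : a = a') (hb : b = b')
    (h : Comm a b) (h' : Comm a' b') : PiecewiseOps.add a b h = PiecewiseOps.add a' b' h' := by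
  subst ha hb
  rfl

theorem sup_congr {A : Type u} [PiecewiseAWStar A] {S S' : Set (Proj A)} (h : S = S')
    (hS : PairwiseCommProj S) (hS' : PairwiseCommProj S') :
    PiecewiseAWStar.sup S hS = PiecewiseAWStar.sup S' hS' := by
  subst h
  rfl

theorem IsPiecewiseHom.map_symmetries {A B : Type u} [PiecewiseOps A] [PiecewiseOps B] {f : A → B}
    (hf : IsPiecewiseHom f) {s : A} (hs : s ∈ symmetries A) : f s ∈ symmetries B := by
  obtain ⟨p, h, rfl⟩ := hs
  have h' := hf.map_comm _ _ h
  have e : f ((-2 : ℂ) • (p : A)) = (-2 : ℂ) • (projMap hf p : B) := hf.map_smul _ _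
  refine ⟨projMap hf p, by rwa [hf.map_one, e] at h', ?_⟩
  rw [hf.map_add]
  exact add_congr hf.map_one e _ _

/-- A bijective piecewise homomorphism that reflects commeasurability has an inverse
homomorphism. -/
theorem IsPiecewiseHom.symm {A B : Type u} [PiecewiseOps A] [PiecewiseOps B] {e : A ≃ B}
    (he : IsPiecewiseHom e) (h : ∀ a b, Comm (e a) (e b) → Comm a b) :
    IsPiecewiseHom e.symm where
  map_comm a b hab := h _ _ (by simpa only [e.apply_symm_apply] using hab)
  map_mul a b hab := e.injective (by
    rw [he.map_mul, e.apply_symm_apply]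
    exact mul_congr (e.apply_symm_apply a).symm (e.apply_symm_apply b).symm _ _)
  map_add a b hab := e.injective (by
    rw [he.map_add, e.apply_symm_apply]
    exact add_congr (e.apply_symm_apply a).symm (e.apply_symm_apply b).symm _ _)
  map_smul z a := e.injective (by rw [he.map_smul, e.apply_symm_apply, e.apply_symm_apply])
  map_star a := e.injective (by rw [he.map_star, e.apply_symm_apply, e.apply_symm_apply])
  map_one := e.injective (by rw [he.map_one, e.apply_symm_apply])

theorem IsPiecewiseAWHom.symm {A B : Type u} [PiecewiseAWStar A] [PiecewiseAWStar B] {e : A ≃ B}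
    (he : IsPiecewiseAWHom e) (h : ∀ a b, Comm (e a) (e b) → Comm a b) :
    IsPiecewiseAWHom e.symm where
  toIsPiecewiseHom := he.toIsPiecewiseHom.symm h
  map_sup S hS := by
    have hinj : Function.Injective (projMap he.toIsPiecewiseHom) := fun p q hpq =>
      Subtype.ext (e.injective (congrArg Subtype.val hpq))
    have hinv : ∀ p, projMap he.toIsPiecewiseHom
        (projMap (he.toIsPiecewiseHom.symm h) p) = p := fun p =>
      Subtype.ext (e.apply_symm_apply _)
    refine hinj ?_
    rw [hinv, he.map_sup]
    refine sup_congr ?_ _ _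
    simp only [Set.image_image, hinv, Set.image_id']

theorem F.map_congr {P Q : Type u} [CompleteOrthomodularLattice P] [CompleteOrthomodularLattice Q]
    {f g : P → Q} (hf : IsCOMLHom f) (hg : IsCOMLHom g) (h : f = g) (x : F P) :
    F.map hf x = F.map hg x := by
  subst h
  rfl

/-! ### The fully faithful functor from active lattices. -/

namespace ActiveLattice

variable {Y Z : ActiveLattice.{u}}

theorem map_act_mul (g h : Y.G) (x : F Y.P) :
    F.map (Y.act_isHom (g * h)) x = F.map (Y.act_isHom g) (F.map (Y.act_isHom h) x) := by
  rw [← F.map_comp]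
  exact F.map_congr _ _ (by rw [map_mul]; rfl) x

theorem map_act_one (x : F Y.P) : F.map (Y.act_isHom 1) x = x := by
  rw [F.map_congr _ IsCOMLHom.id (by rw [map_one]; rfl), F.map_id]

/-- The extended piecewise AW*-algebra of an active lattice. -/
@[reducible] def toExt (Y : ActiveLattice.{u}) : ExtPiecewiseAWStar.{u} where
  A := F Y.P
  latComm_iff _ _ := F.latComm_iff_comm
  coe_compl := F.coe_compl_proj
  sSup_eq _ _ := rfl
  G := Y.G
  isPiecewiseSubgroup := Y.isPiecewiseSubgroup
  symmetries_subset := Y.symmetries_subset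
  closure_symmetries := Y.closure_symmetries
  act :=
    { toFun := fun g =>
        { toFun := F.map (Y.act_isHom g)
          invFun := F.map (Y.act_isHom g⁻¹)
          left_inv := fun x => by rw [← map_act_mul]; simp only [inv_mul_cancel, map_act_one]
          right_inv := fun x => by rw [← map_act_mul]; simp only [mul_inv_cancel, map_act_one] }
      map_one' := Equiv.ext map_act_one
      map_mul' := fun g h => Equiv.ext (map_act_mul g h) }
  act_isHom g := F.isPiecewiseAWHom_map (Y.act_isHom g)
  act_conj := Y.act_conj

theorem toExt_act (g : Y.G) (x : F Y.P) : Y.toExt.act g x = F.map (Y.act_isHom g) x := rfl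

theorem isCOMLHom_projMap_map {f : Y.P → Z.P} (hf : IsCOMLHom f) :
    IsCOMLHom (projMap (F.isPiecewiseHom_map hf)) := by
  have : projMap (F.isPiecewiseHom_map hf) =
      F.proj ∘ f ∘ fun x : Proj (F Y.P) => (x : F Y.P).support := by
    ext1 x
    conv_lhs => rw [← F.proj_support x]
    exact F.projMap_map hf _
  rw [this]
  exact F.isCOMLHom_proj.comp (hf.comp F.isCOMLHom_support)

/-- The morphism of extended piecewise AW*-algebras induced by a morphism of active lattices. -/
def Hom.toExt (f : ActiveLattice.Hom Y Z) : ExtPiecewiseAWStar.Hom Y.toExt Z.toExt where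
  toFun := F.map f.isHom
  isHom := F.isPiecewiseAWHom_map f.isHom
  isCOMLHom := isCOMLHom_projMap_map f.isHom
  group_equivariant := by
    obtain ⟨φ, h₁, h₂⟩ := f.group_equivariant
    refine ⟨φ, h₁, fun u x => ?_⟩
    change F.map f.isHom (F.map (Y.act_isHom u) x) = F.map (Z.act_isHom (φ u)) (F.map f.isHom x)
    rw [← F.map_comp, ← F.map_comp]
    exact F.map_congr _ _ (funext (h₂ u)) x

/-- The functor from active lattices to extended piecewise AW*-algebras. -/
def extFunctor : ActiveLattice.{u} ⥤ ExtPiecewiseAWStar.{u} where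
  obj := toExt
  map f := Hom.toExt f
  map_id _ := ExtPiecewiseAWStar.Hom.ext (funext F.map_id)
  map_comp f g := ExtPiecewiseAWStar.Hom.ext (funext (F.map_comp g.isHom f.isHom))

instance : extFunctor.{u}.Faithful where
  map_injective {Y Z f g} h := by
    refine ActiveLattice.Hom.ext (funext fun p => ?_)
    have h' : F.map f.isHom = F.map g.isHom := congrArg ExtPiecewiseAWStar.Hom.toFun h
    have := congrArg F.support (congrFun h' (F.proj p))
    rwa [F.map_proj, F.map_proj, F.support_proj, F.support_proj] at this

/-- The restriction of a morphism to projections is a lattice morphism `f`. The map `F.map` of `f`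
agrees with the given morphism on projections, hence everywhere by `F.hom_ext`. -/
instance : extFunctor.{u}.Full where
  map_surjective := by
    intro Y Z (h : ExtPiecewiseAWStar.Hom Y.toExt Z.toExt)
    let f : Y.P → Z.P := (fun x : Proj (F Z.P) => (x : F Z.P).support) ∘
      projMap h.isHom.toIsPiecewiseHom ∘ F.proj
    have hf : IsCOMLHom f := F.isCOMLHom_support.comp (h.isCOMLHom.comp F.isCOMLHom_proj)
    have hproj : ∀ p, h.toFun (F.proj p) = F.proj (f p) := fun p =>
      congrArg Subtype.val (F.proj_support (projMap h.isHom.toIsPiecewiseHom (F.proj p))).symm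
    have hmap : F.map hf = h.toFun :=
      F.hom_ext (F.isPiecewiseHom_map hf) h.isHom.toIsPiecewiseHom fun p => by
        rw [F.map_proj, hproj]
    obtain ⟨φ, h₁, h₂⟩ := h.group_equivariant
    refine ⟨⟨f, hf, φ, fun g => (h₁ g).trans (congrFun hmap _).symm, fun u p => ?_⟩,
      ExtPiecewiseAWStar.Hom.ext hmap⟩
    have := h₂ u (F.proj p)
    rw [toExt_act, toExt_act, F.map_proj, hproj, hproj, F.map_proj] at this
    simpa only [F.support_proj] using congrArg F.support this

end ActiveLattice

/-! ### Essential surjectivity. -/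

namespace ExtPiecewiseAWStar

variable {X : ExtPiecewiseAWStar.{u}}

/-- Comparable projections are commeasurable, so their join is one of the suprema that a piecewise
morphism preserves. -/
theorem projMap_monotone {f : X.A → X.A} (hf : IsPiecewiseAWHom f) :
    Monotone (projMap hf.toIsPiecewiseHom) := by
  intro p q hpq
  have hX : PairwiseCommProj {p, q} := by
    have h := (X.latComm_iff p q).1 (latComm_of_le hpq)
    rintro a (rfl | rfl) b (rfl | rfl)
    exacts [comm_refl _, h, comm_symm _ _ h, comm_refl _]
  have := hf.map_sup _ hX
  rw [← X.sSup_eq, ← X.sSup_eq, Set.image_pair, sSup_pair, sSup_pair, sup_eq_right.2 hpq] at this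
  rw [this]
  exact le_sup_left

/-- Piecewise morphisms preserve only suprema of commeasurable sets. With an inverse morphism,
however, monotonicity makes the map an order isomorphism, and so it preserves arbitrary suprema.
This is why the group action on `A` yields lattice automorphisms without a further assumption. -/
theorem isCOMLHom_projMap {f g : X.A → X.A} (hf : IsPiecewiseAWHom f) (hg : IsPiecewiseAWHom g)
    (hfg : ∀ a, f (g a) = a) (hgf : ∀ a, g (f a) = a) :
    IsCOMLHom (projMap hf.toIsPiecewiseHom) where
  map_compl p := by
    obtain ⟨h, e⟩ := X.coe_compl p
    obtain ⟨h', e'⟩ := X.coe_compl (projMap hf.toIsPiecewiseHom p)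
    refine Subtype.ext ?_
    rw [e']
    change f _ = _
    rw [e, hf.map_add]
    exact add_congr hf.map_one (hf.map_smul _ _) _ _
  map_sSup S := by
    refine le_antisymm ?_ (sSup_le ?_)
    · have ht : projMap hf.toIsPiecewiseHom (projMap hg.toIsPiecewiseHom
          (sSup (projMap hf.toIsPiecewiseHom '' S))) = sSup (projMap hf.toIsPiecewiseHom '' S) :=
        Subtype.ext (hfg _)
      rw [← ht]
      refine projMap_monotone hf (sSup_le fun p hp => ?_)
      rw [show p = projMap hg.toIsPiecewiseHom (projMap hf.toIsPiecewiseHom p) from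
        Subtype.ext (hgf _).symm]
      exact projMap_monotone hg (le_sSup ⟨p, hp, rfl⟩)
    · rintro _ ⟨p, hp, rfl⟩
      exact projMap_monotone hf (le_sSup hp)

theorem act_act_inv (g : X.G) (a : X.A) : X.act g (X.act g⁻¹ a) = a := by
  rw [map_inv]
  exact (X.act g).apply_symm_apply a

theorem act_inv_act (g : X.G) (a : X.A) : X.act g⁻¹ (X.act g a) = a := by
  rw [map_inv]
  exact (X.act g).symm_apply_apply a

theorem isCOMLHom_act (g : X.G) : IsCOMLHom (projMap (X.act_isHom g).toIsPiecewiseHom) :=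
  isCOMLHom_projMap (X.act_isHom g) (X.act_isHom g⁻¹) (act_act_inv g) (act_inv_act g)

/-- The action on projections. -/
def projAct (X : ExtPiecewiseAWStar.{u}) : X.G →* Equiv.Perm (Proj X.A) where
  toFun g :=
    { toFun := projMap (X.act_isHom g).toIsPiecewiseHom
      invFun := projMap (X.act_isHom g⁻¹).toIsPiecewiseHom
      left_inv := fun _ => Subtype.ext (act_inv_act g _)
      right_inv := fun _ => Subtype.ext (act_act_inv g _) }
  map_one' := Equiv.ext fun p => Subtype.ext (by
    change X.act 1 p = (p : X.A)
    rw [map_one]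
    rfl)
  map_mul' g h := Equiv.ext fun p => Subtype.ext (by
    change X.act (g * h) p = X.act g (X.act h p)
    rw [map_mul]
    rfl)

/-- Both sides are piecewise homomorphisms on `F (Proj X.A)` acting on projections by the given
action, so `F.hom_ext` applies. -/
theorem toAlgebra_map_act (g : X.G) (x : F (Proj X.A)) :
    X.toAlgebra (F.map (isCOMLHom_act g) x) = X.act g (X.toAlgebra x) := by
  refine congrFun (F.hom_ext (X.isPiecewiseHom_toAlgebra.comp (F.isPiecewiseHom_map _))
    ((X.act_isHom g).toIsPiecewiseHom.comp X.isPiecewiseHom_toAlgebra) fun p => ?_) x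
  rw [Function.comp_apply, Function.comp_apply, F.map_proj, toAlgebra_proj, toAlgebra_proj]
  rfl

theorem isPiecewiseAWHom_algebraEquiv_symm (X : ExtPiecewiseAWStar.{u}) :
    IsPiecewiseAWHom X.algebraEquiv.symm :=
  IsPiecewiseAWHom.symm X.isPiecewiseAWHom_toAlgebra fun _ _ => toAlgebra_comm_iff.1

theorem toAlgebra_symm (a : X.A) : X.toAlgebra (X.algebraEquiv.symm a) = a :=
  X.algebraEquiv.apply_symm_apply a

theorem symm_toAlgebra (x : F (Proj X.A)) : X.algebraEquiv.symm (X.toAlgebra x) = x :=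
  X.algebraEquiv.symm_apply_apply x

theorem toAlgebra_mem_symmetries_iff {x : F (Proj X.A)} :
    X.toAlgebra x ∈ symmetries X.A ↔ x ∈ symmetries (F (Proj X.A)) := by
  refine ⟨fun h => ?_, X.isPiecewiseHom_toAlgebra.map_symmetries⟩
  rw [← symm_toAlgebra x]
  exact X.isPiecewiseAWHom_algebraEquiv_symm.toIsPiecewiseHom.map_symmetries h

/-- The group transported to the algebra constructed from the projections. -/
def groupEquiv (X : ExtPiecewiseAWStar.{u}) : (X.toAlgebra ⁻¹' X.G) ≃ X.G where
  toFun x := ⟨X.toAlgebra x, x.2⟩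
  invFun g := ⟨X.algebraEquiv.symm g, by
    rw [Set.mem_preimage, toAlgebra_symm]
    exact g.2⟩
  left_inv _ := Subtype.ext (symm_toAlgebra _)
  right_inv _ := Subtype.ext (toAlgebra_symm _)

instance : Group (X.toAlgebra ⁻¹' X.G) := X.groupEquiv.group

/-- The transported group is isomorphic to the original one. -/
def groupMulEquiv (X : ExtPiecewiseAWStar.{u}) : (X.toAlgebra ⁻¹' X.G) ≃* X.G :=
  X.groupEquiv.mulEquiv

theorem coe_groupMulEquiv (x : X.toAlgebra ⁻¹' X.G) :
    (X.groupMulEquiv x : X.A) = X.toAlgebra x := rfl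

theorem isPiecewiseSubgroup_preimage (X : ExtPiecewiseAWStar.{u}) :
    IsPiecewiseSubgroup (X.toAlgebra ⁻¹' X.G) where
  subset_unitaries x hx := by
    obtain ⟨h, e⟩ := X.isPiecewiseSubgroup.subset_unitaries hx
    have h' : Comm x (star x) :=
      toAlgebra_comm_iff.1 (by rwa [X.isPiecewiseHom_toAlgebra.map_star])
    refine ⟨h', X.toAlgebra_injective ?_⟩
    rw [X.isPiecewiseHom_toAlgebra.map_mul, X.isPiecewiseHom_toAlgebra.map_one, ← e]
    exact mul_congr rfl (X.isPiecewiseHom_toAlgebra.map_star x) _ _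
  comm_iff g h := by
    rw [← toAlgebra_comm_iff, ← coe_groupMulEquiv, ← coe_groupMulEquiv,
      X.isPiecewiseSubgroup.comm_iff, ← map_mul, ← map_mul, X.groupMulEquiv.injective.eq_iff]
  coe_mul g h hc := X.toAlgebra_injective (by
    rw [X.isPiecewiseHom_toAlgebra.map_mul, ← coe_groupMulEquiv, map_mul]
    exact X.isPiecewiseSubgroup.coe_mul _ _ _)
  coe_one := X.toAlgebra_injective (by
    rw [X.isPiecewiseHom_toAlgebra.map_one, ← coe_groupMulEquiv, map_one]
    exact X.isPiecewiseSubgroup.coe_one)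
  coe_inv g := X.toAlgebra_injective (by
    rw [X.isPiecewiseHom_toAlgebra.map_star, ← coe_groupMulEquiv, map_inv]
    exact X.isPiecewiseSubgroup.coe_inv _)

theorem closure_symmetries_preimage (X : ExtPiecewiseAWStar.{u}) :
    Subgroup.closure {g : X.toAlgebra ⁻¹' X.G | (g : F (Proj X.A)) ∈ symmetries (F (Proj X.A))} =
      ⊤ := by
  refine Subgroup.map_injective (f := X.groupMulEquiv.toMonoidHom) X.groupMulEquiv.injective ?_
  rw [MonoidHom.map_closure, Subgroup.map_top_of_surjective _ X.groupMulEquiv.surjective,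
    ← X.closure_symmetries]
  congr 1
  ext g
  constructor
  · rintro ⟨x, hx, rfl⟩
    exact toAlgebra_mem_symmetries_iff.2 hx
  · intro hg
    obtain ⟨x, rfl⟩ := X.groupMulEquiv.surjective g
    exact ⟨x, toAlgebra_mem_symmetries_iff.1 hg, rfl⟩

/-- The active lattice of an extended piecewise AW*-algebra. -/
@[reducible] def toActiveLattice (X : ExtPiecewiseAWStar.{u}) : ActiveLattice.{u} where
  P := Proj X.A
  G := X.toAlgebra ⁻¹' X.G
  isPiecewiseSubgroup := X.isPiecewiseSubgroup_preimage
  symmetries_subset _ hx := X.symmetries_subset (toAlgebra_mem_symmetries_iff.2 hx)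
  closure_symmetries := X.closure_symmetries_preimage
  act := X.projAct.comp X.groupMulEquiv.toMonoidHom
  act_isHom g := isCOMLHom_act (X.groupMulEquiv g)
  act_conj g h := X.toAlgebra_injective (by
    refine (toAlgebra_map_act (X.groupMulEquiv g) h).trans ?_
    rw [← coe_groupMulEquiv, ← coe_groupMulEquiv, X.act_conj, map_mul, map_mul, map_inv])

/-- An extended piecewise AW*-algebra is isomorphic to that of its active lattice. -/
def isoToExt (X : ExtPiecewiseAWStar.{u}) : X.toActiveLattice.toExt ≅ X where
  hom :=
    { toFun := X.toAlgebra
      isHom := X.isPiecewiseAWHom_toAlgebra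
      isCOMLHom := by
        rw [funext projMap_toAlgebra]
        exact F.isCOMLHom_support
      group_equivariant := ⟨X.groupMulEquiv.toMonoidHom, fun _ => rfl,
        fun u x => toAlgebra_map_act (X.groupMulEquiv u) x⟩ }
  inv :=
    { toFun := X.algebraEquiv.symm
      isHom := X.isPiecewiseAWHom_algebraEquiv_symm
      isCOMLHom := by
        have : projMap X.isPiecewiseAWHom_algebraEquiv_symm.toIsPiecewiseHom = F.proj :=
          funext fun p => Subtype.ext (X.toAlgebra_injective
            ((toAlgebra_symm _).trans (toAlgebra_proj p).symm))
        rw [this]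
        exact F.isCOMLHom_proj
      group_equivariant := ⟨X.groupMulEquiv.symm.toMonoidHom, fun _ => rfl, fun u a =>
        X.toAlgebra_injective (by
          refine (toAlgebra_symm _).trans ?_
          refine Eq.trans ?_ (toAlgebra_map_act (X.groupMulEquiv (X.groupMulEquiv.symm u)) _).symm
          rw [toAlgebra_symm, MulEquiv.apply_symm_apply])⟩ }
  hom_inv_id := ExtPiecewiseAWStar.Hom.ext (funext symm_toAlgebra)
  inv_hom_id := ExtPiecewiseAWStar.Hom.ext (funext toAlgebra_symm)

end ExtPiecewiseAWStar

instance : ActiveLattice.extFunctor.{u}.EssSurj where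
  mem_essImage X := ⟨X.toActiveLattice, ⟨X.isoToExt⟩⟩

instance : ActiveLattice.extFunctor.{u}.IsEquivalence where

end

end ActiveLattices

theorem mainTheorem8 :
    Nonempty (ActiveLattices.ExtPiecewiseAWStar.{u} ≌ ActiveLattices.ActiveLattice.{u}) :=
  ⟨ActiveLattices.ActiveLattice.extFunctor.asEquivalence.symm⟩
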